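/- Let $\Sigma$ be a finite alphabet. For a morphism $h:\Sigma^*\to\Sigma^*$ let $M_h$ be the $\Sigma\times\Sigma$ matrix whose entry $(a,b)$ is the number $|h(b)|_a$ of occurrences of $a$ in $h(b)$; the eigenvalues of $h$ are the complex eigenvalues of $M_h$, and the expanding eigenspace $E_e(M_h)\subseteq\mathbb{C}^{\Sigma}$ is the sum of the generalized eigenspaces of $M_h$ for the eigenvalues of absolute value larger than $1$. The morphism $h$ is primitive if there is $m\in\mathbb{N}$ such that for every letter $a$ the word $h^m(a)$ contains all the letters of $\Sigma$. Let $\operatorname{Fact}^\infty(h)$ be the set of all factors of the words $h^i(a)$ with $i\ge 1$ and $a\in\Sigma$. For a morphism $\Phi:\Sigma^*\to(\mathbb{Z}^d,+)$ let $\ker(\Phi)\subseteq\mathbb{C}^{\Sigma}$ be the kernel of the matrix whose column of index $a$ is $\Phi(a)$. For $k\ge 2$, a $k$-th power modulo $\Phi$ is a word $w_1w_2\cdots w_k$ with $w_i\in\Sigma^*$ and $\Phi(w_1)=\Phi(w_2)=\dots=\Phi(w_k)$, and a word is $k$-th-power-modulo-$\Phi$-free if none of its non-empty factors is a $k$-th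 power modulo $\Phi$. **Theorem.** There is an algorithm which takes as input a finite alphabet $\Sigma$, an integer $k\ge2$, a morphism $h:\Sigma^*\to\Sigma^*$ and a morphism $\Phi:\Sigma^*\to\mathbb{Z}^d$ (given by $d$ and the images of the letters) and which, whenever $h$ is primitive and has no eigenvalue of absolute value $1$ and $E_e(M_h)\cap\ker(\Phi)=\{0\}$, halts and correctly decides whether every word in $\operatorname{Fact}^\infty(h)$ is $k$-th-power-modulo-$\Phi$-free. -/

import Mathlib

noncomputable section

namespace PowerFree

/-- `u` is a factor of the word `w`. -/
def IsFactor {A : Type*} (u w : FreeMonoid A) : Prop :=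
  ∃ p s : FreeMonoid A, w = p * u * s

/-- The set of all factors of the words `h ^ i (a)`, for `i ≥ 1` and letters `a`. -/
def factInfty {A : Type*} (h : FreeMonoid A →* FreeMonoid A) : Set (FreeMonoid A) :=
  {u | ∃ i : ℕ, 1 ≤ i ∧ ∃ a : A, IsFactor u (h^[i] (FreeMonoid.of a))}

/-- Some power of `h` maps every letter to a word that contains all the letters. -/
def IsPrimitive {A : Type*} (h : FreeMonoid A →* FreeMonoid A) : Prop :=
  ∃ m : ℕ, ∀ a b : A, b ∈ (h^[m] (FreeMonoid.of a)).toList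

/-- The matrix of `h`: the entry `(a, b)` is the number of occurrences of `a` in `h (b)`. -/
def morphismMatrix {n : ℕ} (h : FreeMonoid (Fin n) →* FreeMonoid (Fin n)) :
    Matrix (Fin n) (Fin n) ℕ :=
  Matrix.of fun a b => (h (FreeMonoid.of b)).toList.count a

/-- The endomorphism of `ℂⁿ` given by the matrix of `h`. -/
def morphismEnd {n : ℕ} (h : FreeMonoid (Fin n) →* FreeMonoid (Fin n)) :
    Module.End ℂ (Fin n → ℂ) :=
  Matrix.toLin' ((morphismMatrix h).map (Nat.cast : ℕ → ℂ))

/-- The expanding eigenspace: the sum of the generalized eigenspaces of the eigenvalues of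
modulus larger than `1`. -/
def expandingEigenspace {n : ℕ} (f : Module.End ℂ (Fin n → ℂ)) : Submodule ℂ (Fin n → ℂ) :=
  ⨆ (μ : ℂ) (_ : 1 < ‖μ‖), f.maxGenEigenspace μ

/-- The matrix of a morphism from words to `ℤᵈ`: its columns are the images of the letters, so
that the image of a word is the product of this matrix with the Parikh vector of the word. -/
def weightMatrix {n d : ℕ} (Φ : FreeMonoid (Fin n) →* Multiplicative (Fin d → ℤ)) :
    Matrix (Fin d) (Fin n) ℤ :=
  Matrix.of fun i a => (Φ (FreeMonoid.of a)).toAdd i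

/-- The kernel in `ℂⁿ` of the linear map that extends `Φ` to vectors. -/
def weightKer {n d : ℕ} (Φ : FreeMonoid (Fin n) →* Multiplicative (Fin d → ℤ)) :
    Submodule ℂ (Fin n → ℂ) :=
  LinearMap.ker (Matrix.toLin' ((weightMatrix Φ).map (Int.cast : ℤ → ℂ)))

/-- `w` is a concatenation of `k` words that all have the same image under `Φ`. -/
def IsPowerModulo {A G : Type*} [Monoid G] (Φ : FreeMonoid A →* G) (k : ℕ)
    (w : FreeMonoid A) : Prop :=
  ∃ u : Fin k → FreeMonoid A, w = (List.ofFn u).prod ∧ ∀ i j : Fin k, Φ (u i) = Φ (u j)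

/-- No non-empty factor of `w` is a `k`-th power modulo `Φ`. -/
def IsPowerFreeModulo {A G : Type*} [Monoid G] (Φ : FreeMonoid A →* G) (k : ℕ)
    (w : FreeMonoid A) : Prop :=
  ∀ u : FreeMonoid A, IsFactor u w → u ≠ 1 → ¬ IsPowerModulo Φ k u

/-- The input of a decision procedure: the numbers `d` and `k`, and the tables of the images of
the letters `0, …, n - 1` under `h` and under `Φ`. -/
def inputData {n d : ℕ} (k : ℕ) (h : FreeMonoid (Fin n) →* FreeMonoid (Fin n))
    (Φ : FreeMonoid (Fin n) →* Multiplicative (Fin d → ℤ)) :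
    ℕ × ℕ × List (List ℕ) × List (List ℤ) :=
  (d, k, List.ofFn fun a => (h (FreeMonoid.of a)).toList.map Fin.val,
    List.ofFn fun a => List.ofFn (Φ (FreeMonoid.of a)).toAdd)

end PowerFree

end

namespace PowerFree

/-! ### Primitive recursive operations on integers and lists -/

/-! Cut a word at positions `p 0 ≤ … ≤ p k`. The blocks form a power modulo `Φ` exactly when `Φ`
kills the second differences of the Parikh vectors of the prefixes. Put `g = h^N`. Every position in
`g^(t+1)(a)` lies over a position in `g^t(a)`, at a bounded offset, so a cut of `g^r(a)` descends
step by step to a cut of the single letter `a`. Along the descent the second differences satisfy `x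
(t+1) = M (x t) + e t`, with `M` the matrix of `g` and `e` bounded (`IsLift.secondDiff_eq`). The
contracting part of `x t` is controlled from the start, where `x 0` is small. The expanding part is
controlled from the end, where `Φ (x r) = 0` and `Φ` is injective on the expanding space. So all `x
t` are bounded independently of `r` (`HyperbolicCertificate.orbit_bound`).

The state of a cut word records the letters after the cuts, the empty blocks and the second
differences. Bounded second differences leave finitely many states, and a state together with the
offsets determines the next state (`SameState.lift`). If a state occurred twice on the way to the
first power, the later offsets could be replayed from the earlier occurrence and would give an
earlier power. Hence if any power occurs, one occurs within `stateCount` iterations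
(`exists_good_cut_le`), and a finite check decides.

No eigenvalue has to be computed. A certificate gives `N` and integer matrices over a common
denominator `s`: `B / s` approximates the inverse of `M` on the expanding space, extended by zero to
the contracting one, and `T / s` approximates a left inverse of `Φ` on the expanding space. Validity
amounts to finitely many integer inequalities, and these alone imply the bound. Hyperbolicity and
the kernel condition guarantee that a certificate exists (`exists_hyperbolicCertificate`), so an
unbounded search for one halts. Primitivity ensures that nothing is lost in passing from `h` to
`h^N` (`IsPrimitive.exists_isFactor`). -/

theorem primrec_intEquivNatSumNat : Primrec Equiv.intEquivNatSumNat :=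
  Primrec.encode_iff.1 <| (Primrec.encode (α := ℤ)).of_eq fun z => by
    cases z <;> rfl

theorem primrec_intEquivNatSumNat_symm : Primrec Equiv.intEquivNatSumNat.symm :=
  Primrec.encode_iff.1 <| (Primrec.encode (α := ℕ ⊕ ℕ)).of_eq fun z => by
    cases z <;> rfl

theorem primrec_int_toNat : Primrec Int.toNat :=
  (Primrec.sumCasesOn primrec_intEquivNatSumNat (g := fun _ n => n) (h := fun _ _ => 0)
    Primrec₂.right (Primrec₂.const 0)).of_eq fun z => by cases z <;> rfl

theorem primrec_int_neg_toNat : Primrec fun z : ℤ => (-z).toNat :=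
  (Primrec.sumCasesOn primrec_intEquivNatSumNat (g := fun _ _ => 0) (h := fun _ n => n + 1)
    (Primrec₂.const 0) (Primrec.succ.comp₂ Primrec₂.right)).of_eq fun z => by
      cases z with
      | ofNat n => cases n <;> rfl
      | negSucc n => rfl

/-- Every integer is `z.toNat - (-z).toNat`, so the ring operations on `ℤ` reduce to arithmetic in
`ℕ` followed by this subtraction. -/
theorem primrec_nat_sub_int : Primrec₂ fun m n : ℕ => (m : ℤ) - (n : ℤ) :=
  (Primrec.ite (c := fun p : ℕ × ℕ => p.2 ≤ p.1)
    (f := fun p => Equiv.intEquivNatSumNat.symm (Sum.inl (p.1 - p.2)))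
    (g := fun p => Equiv.intEquivNatSumNat.symm (Sum.inr (p.2 - p.1 - 1)))
    (Primrec.nat_le.comp Primrec.snd Primrec.fst)
    (primrec_intEquivNatSumNat_symm.comp (Primrec.sumInl.comp
      (Primrec.nat_sub.comp Primrec.fst Primrec.snd)))
    (primrec_intEquivNatSumNat_symm.comp (Primrec.sumInr.comp
      (Primrec.nat_sub.comp (Primrec.nat_sub.comp Primrec.snd Primrec.fst)
        (Primrec.const 1))))).of_eq fun p => by
    obtain ⟨m, n⟩ := p
    dsimp only
    split_ifs with h
    · change ((m - n : ℕ) : ℤ) = m - n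
      omega
    · change Int.negSucc (n - m - 1) = m - n
      omega

theorem primrec_int_add : Primrec₂ ((· + ·) : ℤ → ℤ → ℤ) :=
  (primrec_nat_sub_int.comp
    (Primrec.nat_add.comp (primrec_int_toNat.comp Primrec.fst) (primrec_int_toNat.comp Primrec.snd))
    (Primrec.nat_add.comp (primrec_int_neg_toNat.comp Primrec.fst)
      (primrec_int_neg_toNat.comp Primrec.snd))).of_eq fun p => by
    obtain ⟨m, n⟩ := p
    dsimp only
    omega

theorem primrec_int_sub : Primrec₂ ((· - ·) : ℤ → ℤ → ℤ) :=
  (primrec_nat_sub_int.comp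
    (Primrec.nat_add.comp (primrec_int_toNat.comp Primrec.fst)
      (primrec_int_neg_toNat.comp Primrec.snd))
    (Primrec.nat_add.comp (primrec_int_neg_toNat.comp Primrec.fst)
      (primrec_int_toNat.comp Primrec.snd))).of_eq fun p => by
    obtain ⟨m, n⟩ := p
    dsimp only
    omega

theorem primrec_int_mul : Primrec₂ ((· * ·) : ℤ → ℤ → ℤ) :=
  (primrec_nat_sub_int.comp
    (Primrec.nat_add.comp
      (Primrec.nat_mul.comp (primrec_int_toNat.comp Primrec.fst)
        (primrec_int_toNat.comp Primrec.snd))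
      (Primrec.nat_mul.comp (primrec_int_neg_toNat.comp Primrec.fst)
        (primrec_int_neg_toNat.comp Primrec.snd)))
    (Primrec.nat_add.comp
      (Primrec.nat_mul.comp (primrec_int_toNat.comp Primrec.fst)
        (primrec_int_neg_toNat.comp Primrec.snd))
      (Primrec.nat_mul.comp (primrec_int_neg_toNat.comp Primrec.fst)
        (primrec_int_toNat.comp Primrec.snd)))).of_eq fun p => by
    obtain ⟨m, n⟩ := p
    dsimp only
    have hm : m = (m.toNat : ℤ) - ((-m).toNat : ℤ) := by omega
    have hn : n = (n.toNat : ℤ) - ((-n).toNat : ℤ) := by omega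
    conv_rhs => rw [hm, hn]
    push_cast
    ring

theorem primrec_natAbs : Primrec Int.natAbs :=
  (Primrec.nat_add.comp primrec_int_toNat primrec_int_neg_toNat).of_eq fun z => by omega

theorem primrec_natCast_int : Primrec fun n : ℕ => (n : ℤ) :=
  (primrec_nat_sub_int.comp Primrec.id (Primrec.const 0)).of_eq fun n => by simp

theorem primrec_list_sum_map {α β σ : Type*} [Primcodable α] [Primcodable β] [Primcodable σ]
    [AddMonoid σ] (hadd : Primrec₂ ((· + ·) : σ → σ → σ)) {f : α → List β} {g : α → β → σ}
    (hf : Primrec f) (hg : Primrec₂ g) : Primrec fun a => ((f a).map (g a)).sum :=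
  (Primrec.list_foldr (h := fun _ (p : σ × σ) => p.1 + p.2) (Primrec.list_map hf hg)
    (Primrec.const 0) (hadd.comp₂ (Primrec.fst.comp₂ Primrec₂.right)
      (Primrec.snd.comp₂ Primrec₂.right))).of_eq fun _ => rfl

theorem primrec_list_count : Primrec₂ fun (i : ℕ) (w : List ℕ) => w.count i :=
  ((Primrec.list_length.comp₂ (PrimrecRel.listFilter (R := fun a b : ℕ => a = b)
    Primrec.eq)).swap).of_eq fun i w => by
      simp only [Function.swap, List.count, List.countP_eq_length_filter]
      congr 1

theorem primrec_pow : Primrec₂ ((· ^ ·) : ℕ → ℕ → ℕ) :=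
  Primrec₂.unpaired'.1 Nat.Primrec.pow

theorem primrecPred_forall_mem {α β : Type*} [Primcodable α] [Primcodable β] {f : α → List β}
    {p : α → β → Prop} (hf : Primrec f) (hp : PrimrecRel p) :
    PrimrecPred fun a => ∀ b ∈ f a, p a b :=
  (PrimrecRel.forall_mem_list (R := fun b a => p a b) hp.swap).comp hf Primrec.id

theorem primrecPred_forall_lt {α : Type*} [Primcodable α] {f : α → ℕ} {p : α → ℕ → Prop}
    (hf : Primrec f) (hp : PrimrecRel p) : PrimrecPred fun a => ∀ i < f a, p a i :=
  (primrecPred_forall_mem (Primrec.list_range.comp hf) hp).of_eq fun a => by simp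

/-- All lists of length `k` whose entries are smaller than `m`. -/
def tuples (m : ℕ) : ℕ → List (List ℕ)
  | 0 => [[]]
  | k + 1 => (tuples m k).flatMap fun l => (List.range m).map fun x => x :: l

theorem mem_tuples {m k : ℕ} {l : List ℕ} :
    l ∈ tuples m k ↔ l.length = k ∧ ∀ x ∈ l, x < m := by
  induction k generalizing l with
  | zero =>
    simp only [tuples, List.mem_singleton, List.length_eq_zero_iff]
    constructor
    · rintro rfl; simp
    · exact fun h => h.1
  | succ k ih =>
    simp only [tuples, List.mem_flatMap, List.mem_map, List.mem_range]
    constructor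
    · rintro ⟨l', hl', x, hx, rfl⟩
      have := ih.1 hl'
      simpa [this.1, hx] using this.2
    · rintro ⟨h1, h2⟩
      cases l with
      | nil => simp at h1
      | cons x l' =>
        simp only [List.length_cons, Nat.add_right_cancel_iff] at h1
        exact ⟨l', ih.2 ⟨h1, fun y hy => h2 y (List.mem_cons_of_mem _ hy)⟩, x,
          h2 x List.mem_cons_self, rfl⟩

theorem primrec_tuples : Primrec₂ tuples := by
  have h : Primrec₂ fun (m : ℕ) (p : ℕ × List (List ℕ)) =>
      p.2.flatMap fun l => (List.range m).map fun x => x :: l := by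
    refine Primrec.list_flatMap (Primrec.snd.comp Primrec.snd) ?_
    refine Primrec.list_map (Primrec.list_range.comp (Primrec.fst.comp Primrec.fst)) ?_
    exact Primrec.list_cons.comp Primrec.snd (Primrec.snd.comp Primrec.fst)
  exact (Primrec.nat_rec (f := fun _ : ℕ => [[]]) (Primrec.const _) h).of_eq fun m k => by
    induction k with
    | zero => rfl
    | succ k ih =>
      simp only [tuples, ← ih]

/-! ### The decision procedure -/

/-- The image of a word of natural numbers under the substitution with table `G`. -/
def substWord (G : List (List ℕ)) (w : List ℕ) : List ℕ :=
  w.flatMap fun a => G.getD a []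

/-- The table of the `N`-th iterate of the substitution with table `H`. -/
def iterTable (H : List (List ℕ)) (N : ℕ) : List (List ℕ) :=
  (List.range H.length).map fun a => (substWord H)^[N] [a]

/-- An entry of a matrix given as a list of rows. -/
def matEntry (U : List (List ℤ)) (i j : ℕ) : ℤ := (U.getD i []).getD j 0

/-- The sum of the absolute values of the first `n` entries of row `i`. -/
def absRowSum (n : ℕ) (U : List (List ℤ)) (i : ℕ) : ℕ :=
  ((List.range n).map fun c => (matEntry U i c).natAbs).sum

/-- The `n × n` matrix `T Pᵀ`, for `T` and `P` with rows of length `d`. -/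
def mulTable (n d : ℕ) (T P : List (List ℤ)) : List (List ℤ) :=
  (List.range n).map fun i => (List.range n).map fun c =>
    ((List.range d).map fun t => matEntry T i t * matEntry P c t).sum

/-- The matrix `s M(G) - U M(V)`, where `M(G)` and `M(V)` are the matrices of the substitutions
with tables `G` and `V`. -/
def residualTable (n s : ℕ) (G V : List (List ℕ)) (U : List (List ℤ)) : List (List ℤ) :=
  (List.range n).map fun i => (List.range n).map fun b =>
    (s : ℤ) * ((G.getD b []).count i : ℤ) - ((V.getD b []).map fun c => matEntry U i c).sum

/-- The conditions on a certificate, where `G` is the table of a power of the morphism. -/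
def CertifiesTable (n d s κ ℓ : ℕ) (G : List (List ℕ)) (P B T : List (List ℤ)) : Prop :=
  1 ≤ s ∧ (∀ b < n, (G.getD b []).length ≤ ℓ) ∧
    ∀ i < n, 4 * absRowSum n (residualTable n s G (iterTable G 2) B) i ≤ s ∧
      4 * absRowSum n B i ≤ s ∧
      4 * absRowSum n (residualTable n s G G (mulTable n d T P)) i ≤ s ∧
      absRowSum n (mulTable n d T P) i ≤ κ * s

/-- The bound on the second differences given by a certificate. -/
def diffBound (n κ ℓ : ℕ) : ℕ := 2 * (n * ℓ * (4 * ℓ) + 2 * (4 * ℓ) + κ * (4 * ℓ) + 4)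

/-- The number of states. -/
def stateCount (n k β : ℕ) : ℕ :=
  (n + 1) ^ (k + 1) * 2 ^ k * ((2 * β + 1) ^ n) ^ (k - 1)

/-- The weight of the prefix of length `p` of `w`, in coordinate `t`. -/
def prefixWeight (P : List (List ℤ)) (t : ℕ) (w : List ℕ) (p : ℕ) : ℤ :=
  ((w.take p).map fun a => matEntry P a t).sum

/-- The positions in `l` cut a nonempty `k`-th power out of `w`. -/
def CutsPower (d k : ℕ) (P : List (List ℤ)) (w l : List ℕ) : Prop :=
  (∀ j < k, l.getD j 0 ≤ l.getD (j + 1) 0) ∧ l.getD 0 0 < l.getD k 0 ∧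
    ∀ j < k - 1, ∀ t < d, prefixWeight P t w (l.getD (j + 2) 0) + prefixWeight P t w (l.getD j 0) =
      prefixWeight P t w (l.getD (j + 1) 0) + prefixWeight P t w (l.getD (j + 1) 0)

/-- No power occurs in the first `m` images of the letters. -/
def NoPowerUpTo (m n d k : ℕ) (G : List (List ℕ)) (P : List (List ℤ)) : Prop :=
  ∀ i < m, ∀ a < n, ∀ l ∈ tuples (((substWord G)^[i + 1] [a]).length + 1) (k + 1),
    ¬ CutsPower d k P ((substWord G)^[i + 1] [a]) l

/-! ### Primitive recursiveness of the certificate check and of the bounded check for powers -/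

theorem primrec_substWord : Primrec₂ substWord :=
  Primrec.list_flatMap Primrec.snd
    ((Primrec.list_getD []).comp (Primrec.fst.comp Primrec.fst) Primrec.snd)

theorem primrec_substWord_iterate :
    Primrec fun p : (List (List ℕ) × ℕ) × ℕ => (substWord p.1.1)^[p.1.2] [p.2] :=
  Primrec.nat_iterate (Primrec.snd.comp Primrec.fst)
    (Primrec.list_cons.comp Primrec.snd (Primrec.const []))
    (primrec_substWord.comp (Primrec.fst.comp (Primrec.fst.comp Primrec.fst)) Primrec.snd)

theorem primrec_iterTable : Primrec₂ iterTable :=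
  Primrec.list_map (Primrec.list_range.comp (Primrec.list_length.comp Primrec.fst))
    primrec_substWord_iterate

theorem primrec_matEntry : Primrec fun p : List (List ℤ) × ℕ × ℕ => matEntry p.1 p.2.1 p.2.2 :=
  (Primrec.list_getD 0).comp ((Primrec.list_getD []).comp Primrec.fst
    (Primrec.fst.comp Primrec.snd)) (Primrec.snd.comp Primrec.snd)

theorem Primrec.matEntry {α : Type*} [Primcodable α] {U : α → List (List ℤ)} {i j : α → ℕ}
    (hU : Primrec U) (hi : Primrec i) (hj : Primrec j) :
    Primrec fun a => matEntry (U a) (i a) (j a) :=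
  primrec_matEntry.comp (hU.pair (hi.pair hj))

theorem Primrec.absRowSum {α : Type*} [Primcodable α] {n : α → ℕ} {U : α → List (List ℤ)}
    {i : α → ℕ} (hn : Primrec n) (hU : Primrec U) (hi : Primrec i) :
    Primrec fun a => absRowSum (n a) (U a) (i a) :=
  primrec_list_sum_map Primrec.nat_add (Primrec.list_range.comp hn)
    (primrec_natAbs.comp (Primrec.matEntry (hU.comp Primrec.fst) (hi.comp Primrec.fst)
      Primrec.snd))

theorem Primrec.table {α : Type*} [Primcodable α] {n : α → ℕ} {f : α → ℕ → ℕ → ℤ}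
    (hn : Primrec n) (hf : Primrec fun p : (α × ℕ) × ℕ => f p.1.1 p.1.2 p.2) :
    Primrec fun a => (List.range (n a)).map fun i => (List.range (n a)).map (f a i) :=
  Primrec.list_map (Primrec.list_range.comp hn)
    (Primrec.list_map (Primrec.list_range.comp (hn.comp Primrec.fst)) hf)

theorem Primrec.mulTable {α : Type*} [Primcodable α] {n d : α → ℕ} {T P : α → List (List ℤ)}
    (hn : Primrec n) (hd : Primrec d) (hT : Primrec T) (hP : Primrec P) :
    Primrec fun a => mulTable (n a) (d a) (T a) (P a) := by
  have h1 := Primrec.fst (α := (α × ℕ) × ℕ) (β := ℕ)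
  refine Primrec.table hn (primrec_list_sum_map primrec_int_add
    (Primrec.list_range.comp (hd.comp (Primrec.fst.comp Primrec.fst))) ?_)
  exact primrec_int_mul.comp
    (Primrec.matEntry (hT.comp (Primrec.fst.comp (Primrec.fst.comp h1)))
      (Primrec.snd.comp (Primrec.fst.comp h1)) Primrec.snd)
    (Primrec.matEntry (hP.comp (Primrec.fst.comp (Primrec.fst.comp h1)))
      (Primrec.snd.comp h1) Primrec.snd)

theorem Primrec.residualTable {α : Type*} [Primcodable α] {n s : α → ℕ}
    {G V : α → List (List ℕ)} {U : α → List (List ℤ)}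
    (hn : Primrec n) (hs : Primrec s) (hG : Primrec G) (hV : Primrec V) (hU : Primrec U) :
    Primrec fun a => residualTable (n a) (s a) (G a) (V a) (U a) := by
  have h1 := Primrec.fst (α := (α × ℕ) × ℕ) (β := ℕ)
  have h0 := (Primrec.fst (α := α) (β := ℕ)).comp (Primrec.fst (α := α × ℕ) (β := ℕ))
  refine Primrec.table hn (primrec_int_sub.comp (primrec_int_mul.comp
    (primrec_natCast_int.comp (hs.comp h0)) (primrec_natCast_int.comp (primrec_list_count.comp
      (Primrec.snd.comp Primrec.fst) ((Primrec.list_getD []).comp (hG.comp h0) Primrec.snd))))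
    (primrec_list_sum_map primrec_int_add
      ((Primrec.list_getD []).comp (hV.comp h0) Primrec.snd) ?_))
  exact Primrec.matEntry (hU.comp (h0.comp h1)) (Primrec.snd.comp (Primrec.fst.comp h1)) Primrec.snd

theorem PrimrecPred.certifiesTable {α : Type*} [Primcodable α] {n d s κ ℓ : α → ℕ}
    {G : α → List (List ℕ)} {P B T : α → List (List ℤ)} (hn : Primrec n) (hd : Primrec d)
    (hs : Primrec s) (hκ : Primrec κ) (hl : Primrec ℓ) (hG : Primrec G) (hP : Primrec P)
    (hB : Primrec B) (hT : Primrec T) :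
    PrimrecPred fun a => CertifiesTable (n a) (d a) (s a) (κ a) (ℓ a) (G a) (P a) (B a) (T a) := by
  have hTP := Primrec.mulTable hn hd hT hP
  have hR1 := Primrec.residualTable hn hs hG (primrec_iterTable.comp hG (Primrec.const 2)) hB
  have hR2 := Primrec.residualTable hn hs hG hG hTP
  have h0 := Primrec.fst (α := α) (β := ℕ)
  have h1 := Primrec.snd (α := α) (β := ℕ)
  have four {f : α → List (List ℤ)} (hf : Primrec f) :
      PrimrecPred fun p : α × ℕ => 4 * absRowSum (n p.1) (f p.1) p.2 ≤ s p.1 :=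
    Primrec.nat_le.comp (Primrec.nat_mul.comp (Primrec.const 4)
      (Primrec.absRowSum (hn.comp h0) (hf.comp h0) h1)) (hs.comp h0)
  refine (Primrec.nat_le.comp (Primrec.const 1) hs).and
    ((primrecPred_forall_lt hn ?_).and (primrecPred_forall_lt hn ?_))
  · exact Primrec.nat_le.comp (Primrec.list_length.comp
      ((Primrec.list_getD []).comp (hG.comp h0) h1)) (hl.comp h0)
  · exact (four hR1).and ((four hB).and ((four hR2).and
      (Primrec.nat_le.comp (Primrec.absRowSum (hn.comp h0) (hTP.comp h0) h1)
        (Primrec.nat_mul.comp (hκ.comp h0) (hs.comp h0)))))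

theorem Primrec.diffBound {α : Type*} [Primcodable α] {n κ ℓ : α → ℕ} (hn : Primrec n)
    (hκ : Primrec κ) (hl : Primrec ℓ) : Primrec fun a => diffBound (n a) (κ a) (ℓ a) := by
  have h4 := Primrec.nat_mul.comp (Primrec.const 4) hl
  exact Primrec.nat_mul.comp (Primrec.const 2) (Primrec.nat_add.comp (Primrec.nat_add.comp
    (Primrec.nat_add.comp (Primrec.nat_mul.comp (Primrec.nat_mul.comp hn hl) h4)
      (Primrec.nat_mul.comp (Primrec.const 2) h4)) (Primrec.nat_mul.comp hκ h4)) (Primrec.const 4))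

theorem Primrec.stateCount {α : Type*} [Primcodable α] {n k β : α → ℕ} (hn : Primrec n)
    (hk : Primrec k) (hβ : Primrec β) : Primrec fun a => stateCount (n a) (k a) (β a) :=
  Primrec.nat_mul.comp (Primrec.nat_mul.comp (primrec_pow.comp (Primrec.succ.comp hn)
    (Primrec.succ.comp hk)) (primrec_pow.comp (Primrec.const 2) hk))
    (primrec_pow.comp (primrec_pow.comp (Primrec.succ.comp
      (Primrec.nat_mul.comp (Primrec.const 2) hβ)) hn) (Primrec.nat_sub.comp hk (Primrec.const 1)))

theorem Primrec.prefixWeight {α : Type*} [Primcodable α] {P : α → List (List ℤ)} {t p : α → ℕ}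
    {w : α → List ℕ} (hP : Primrec P) (ht : Primrec t) (hw : Primrec w) (hp : Primrec p) :
    Primrec fun a => prefixWeight (P a) (t a) (w a) (p a) :=
  primrec_list_sum_map primrec_int_add (Primrec.list_take.comp hp hw)
    (Primrec.matEntry (hP.comp Primrec.fst) Primrec.snd (ht.comp Primrec.fst))

theorem PrimrecPred.cutsPower {α : Type*} [Primcodable α] {d k : α → ℕ} {P : α → List (List ℤ)}
    {w l : α → List ℕ} (hd : Primrec d) (hk : Primrec k) (hP : Primrec P) (hw : Primrec w)
    (hl : Primrec l) : PrimrecPred fun a => CutsPower (d a) (k a) (P a) (w a) (l a) := by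
  have get {β : Type _} [Primcodable β] {u : β → α} {i : β → ℕ} (hu : Primrec u)
      (hi : Primrec i) : Primrec fun b => (l (u b)).getD (i b) 0 :=
    (Primrec.list_getD 0).comp (hl.comp hu) hi
  have h0 := Primrec.fst (α := α) (β := ℕ)
  have h1 := Primrec.snd (α := α) (β := ℕ)
  refine (primrecPred_forall_lt hk ?_).and ((Primrec.nat_lt.comp
    (get Primrec.id (Primrec.const 0)) (get Primrec.id hk)).and
    (primrecPred_forall_lt (Primrec.nat_sub.comp hk (Primrec.const 1))
      (primrecPred_forall_lt (hd.comp h0) ?_)))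
  · exact Primrec.nat_le.comp (get h0 h1) (get h0 (Primrec.succ.comp h1))
  · have e0 := h0.comp (Primrec.fst (α := α × ℕ) (β := ℕ))
    have e1 := h1.comp (Primrec.fst (α := α × ℕ) (β := ℕ))
    have wt {i : (α × ℕ) × ℕ → ℕ} (hi : Primrec i) :=
      Primrec.prefixWeight (hP.comp e0) (Primrec.snd (α := α × ℕ) (β := ℕ)) (hw.comp e0)
        (get e0 hi)
    have e2 := wt (Primrec.succ.comp e1)
    exact Primrec.eq.comp (primrec_int_add.comp (wt (Primrec.succ.comp (Primrec.succ.comp e1)))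
      (wt e1)) (primrec_int_add.comp e2 e2)

theorem PrimrecPred.noPowerUpTo {α : Type*} [Primcodable α] {m n d k : α → ℕ}
    {G : α → List (List ℕ)} {P : α → List (List ℤ)} (hm : Primrec m) (hn : Primrec n)
    (hd : Primrec d) (hk : Primrec k) (hG : Primrec G) (hP : Primrec P) :
    PrimrecPred fun a => NoPowerUpTo (m a) (n a) (d a) (k a) (G a) (P a) := by
  have h0 := (Primrec.fst (α := α) (β := ℕ)).comp (Primrec.fst (α := α × ℕ) (β := ℕ))
  have hW : Primrec fun p : (α × ℕ) × ℕ => (substWord (G p.1.1))^[p.1.2 + 1] [p.2] :=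
    primrec_substWord_iterate.comp (((hG.comp h0).pair (Primrec.succ.comp
      (Primrec.snd.comp Primrec.fst))).pair Primrec.snd)
  have h1 := Primrec.fst (α := (α × ℕ) × ℕ) (β := List ℕ)
  refine primrecPred_forall_lt hm (primrecPred_forall_lt (hn.comp Primrec.fst)
    (primrecPred_forall_mem (primrec_tuples.comp (Primrec.succ.comp (Primrec.list_length.comp hW))
      (Primrec.succ.comp (hk.comp h0))) (PrimrecPred.not ?_)))
  exact PrimrecPred.cutsPower (hd.comp (h0.comp h1)) (hk.comp (h0.comp h1)) (hP.comp (h0.comp h1))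
    (hW.comp h1) Primrec.snd

/-! ### The unbounded search for a certificate -/

/-- A certificate consists of an exponent `N`, a denominator `s`, numerators of two matrices and
two bounds. -/
abbrev Certificate := ℕ × ℕ × List (List ℤ) × List (List ℤ) × ℕ × ℕ

/-- The certificate `c` is valid for the input `x`. -/
def Certifies (x : ℕ × ℕ × List (List ℕ) × List (List ℤ)) (c : Certificate) : Prop :=
  1 ≤ c.1 ∧ CertifiesTable x.2.2.1.length x.1 c.2.1 c.2.2.2.2.1 c.2.2.2.2.2
    (iterTable x.2.2.1 c.1) x.2.2.2 c.2.2.1 c.2.2.2.1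

/-- The answer on the input `x`, given a valid certificate. -/
def CertifiedAnswer (x : ℕ × ℕ × List (List ℕ) × List (List ℤ)) (c : Certificate) : Prop :=
  NoPowerUpTo (stateCount x.2.2.1.length x.2.1
    (diffBound x.2.2.1.length c.2.2.2.2.1 c.2.2.2.2.2)) x.2.2.1.length x.1 x.2.1
    (iterTable x.2.2.1 c.1) x.2.2.2

open Classical in
/-- The answer from the certificate `c`, if it is valid. -/
noncomputable def answerFrom (x : ℕ × ℕ × List (List ℕ) × List (List ℤ)) (c : Certificate) :
    Option Bool :=
  if Certifies x c then some (decide (CertifiedAnswer x c)) else none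

/-- Search for a valid certificate and compute the answer from it. -/
noncomputable def decider (x : ℕ × ℕ × List (List ℕ) × List (List ℤ)) : Part Bool :=
  Nat.rfindOpt fun m => (@Encodable.decode Certificate Primcodable.toEncodable m).bind (answerFrom x)

theorem primrecPred_certifies :
    PrimrecPred fun p : (ℕ × ℕ × List (List ℕ) × List (List ℤ)) × Certificate =>
      Certifies p.1 p.2 := by
  have hx := Primrec.fst (α := ℕ × ℕ × List (List ℕ) × List (List ℤ)) (β := Certificate)
  have hc := Primrec.snd (α := ℕ × ℕ × List (List ℕ) × List (List ℤ)) (β := Certificate)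
  have x2 := Primrec.snd.comp (Primrec.snd.comp hx)
  have hH := Primrec.fst.comp x2
  have c2 := Primrec.snd.comp hc
  have c3 := Primrec.snd.comp c2
  have c4 := Primrec.snd.comp c3
  have c5 := Primrec.snd.comp c4
  exact (Primrec.nat_le.comp (Primrec.const 1) (Primrec.fst.comp hc)).and
    (PrimrecPred.certifiesTable (Primrec.list_length.comp hH) (Primrec.fst.comp hx)
      (Primrec.fst.comp c2) (Primrec.fst.comp c5) (Primrec.snd.comp c5)
      (primrec_iterTable.comp hH (Primrec.fst.comp hc)) (Primrec.snd.comp x2)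
      (Primrec.fst.comp c3) (Primrec.fst.comp c4))

theorem primrecPred_certifiedAnswer :
    PrimrecPred fun p : (ℕ × ℕ × List (List ℕ) × List (List ℤ)) × Certificate =>
      CertifiedAnswer p.1 p.2 := by
  have hx := Primrec.fst (α := ℕ × ℕ × List (List ℕ) × List (List ℤ)) (β := Certificate)
  have hc := Primrec.snd (α := ℕ × ℕ × List (List ℕ) × List (List ℤ)) (β := Certificate)
  have x1 := Primrec.snd.comp hx
  have x2 := Primrec.snd.comp x1
  have hH := Primrec.fst.comp x2
  have hn := Primrec.list_length.comp hH
  have c5 := Primrec.snd.comp (Primrec.snd.comp (Primrec.snd.comp (Primrec.snd.comp hc)))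
  exact PrimrecPred.noPowerUpTo (Primrec.stateCount hn (Primrec.fst.comp x1)
    (Primrec.diffBound hn (Primrec.fst.comp c5) (Primrec.snd.comp c5))) hn
    (Primrec.fst.comp hx) (Primrec.fst.comp x1)
    (primrec_iterTable.comp hH (Primrec.fst.comp hc)) (Primrec.snd.comp x2)

theorem primrec_answerFrom : Primrec₂ answerFrom := by
  classical
  exact Primrec.ite primrecPred_certifies
    (Primrec.option_some.comp primrecPred_certifiedAnswer.decide) (Primrec.const none)

theorem partrec_decider : Partrec decider := by
  have h : Primrec₂ fun (x : ℕ × ℕ × List (List ℕ) × List (List ℤ)) (m : ℕ) =>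
      (@Encodable.decode Certificate Primcodable.toEncodable m).bind (answerFrom x) :=
    Primrec.option_bind (Primrec.decode.comp Primrec.snd)
      (primrec_answerFrom.comp (Primrec.fst.comp Primrec.fst) Primrec.snd)
  exact Partrec.rfindOpt h.to_comp

/-- The search may stop at any valid certificate, so correctness is required for all of them; the
existence of one serves only for termination. -/
theorem exists_mem_decider {x : ℕ × ℕ × List (List ℕ) × List (List ℤ)} {Q : Prop}
    (hex : ∃ c, Certifies x c) (hQ : ∀ c, Certifies x c → (CertifiedAnswer x c ↔ Q)) :
    ∃ b ∈ decider x, (b = true ↔ Q) := by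
  classical
  obtain ⟨c, hc⟩ := hex
  have hdom : (decider x).Dom := by
    unfold decider
    rw [Nat.rfindOpt_dom]
    refine ⟨@Encodable.encode Certificate Primcodable.toEncodable c, decide (CertifiedAnswer x c), ?_⟩
    rw [Encodable.encodek, Option.bind_some, answerFrom, if_pos hc]
    exact Option.mem_some_iff.2 (by congr)
  refine ⟨(decider x).get hdom, Part.get_mem hdom, ?_⟩
  obtain ⟨m, hm⟩ := Nat.rfindOpt_spec (Part.get_mem hdom)
  obtain ⟨c', -, hc'⟩ := Option.bind_eq_some_iff.1 hm
  unfold answerFrom at hc'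
  split_ifs at hc' with h
  rw [← Option.some.inj hc', decide_eq_true_iff, hQ c' h]

end PowerFree

namespace PowerFree

/-! ### Cutting images of words -/

section Cuts

variable {A : Type*} (g : A → List A)

/-- `s` is the position of a letter in the image of the letter `o`; the end of a word counts as a
letter whose only position is `0`. -/
def IsOffset (o : Option A) (s : ℕ) : Prop :=
  s < (o.elim [] g).length ∨ o = none ∧ s = 0

theorem IsOffset.le {g : A → List A} {o : Option A} {s : ℕ} (h : IsOffset g o s) :
    s ≤ (o.elim [] g).length := by
  rcases h with h | ⟨-, rfl⟩ <;> omega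

/-- A position on the border of two images gets offset `0` in the later one, and empty images are
skipped. So the offset is strictly inside an image, except at the end of the word. -/
theorem exists_isOffset (V : List A) {p : ℕ} (hp : p ≤ (V.flatMap g).length) :
    ∃ p' ≤ V.length, ∃ s, IsOffset g V[p']? s ∧ p = ((V.take p').flatMap g).length + s := by
  induction V generalizing p with
  | nil => exact ⟨0, le_rfl, 0, Or.inr ⟨rfl, rfl⟩, by simpa using hp⟩
  | cons c V ih =>
    by_cases h : p < (g c).length
    · exact ⟨0, Nat.zero_le _, p, Or.inl (by simpa using h), by simp⟩
    · rw [List.flatMap_cons, List.length_append] at hp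
      obtain ⟨p', hp', s, hs, e⟩ := ih (p := p - (g c).length) (by omega)
      refine ⟨p' + 1, by simpa using hp', s, by simpa using hs, ?_⟩
      rw [List.take_succ_cons, List.flatMap_cons, List.length_append]
      omega

/-- Strict offsets make the lift strictly monotone in the base position. Hence descent preserves the
order of cuts, and two cuts coincide only if base positions and offsets do. -/
theorem flatMap_take_lt {V : List A} {p q s : ℕ} (hpq : p < q) (hq : q ≤ V.length)
    (hs : IsOffset g V[p]? s) :
    ((V.take p).flatMap g).length + s < ((V.take q).flatMap g).length := by
  have hp : p < V.length := by omega
  have hs' : s < (g V[p]).length := by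
    rcases hs with hs | ⟨h, -⟩
    · simpa [List.getElem?_eq_getElem hp] using hs
    · simp [List.getElem?_eq_getElem hp] at h
  obtain ⟨r, rfl⟩ := Nat.exists_eq_add_of_lt hpq
  have : V.take (p + r + 1) = V.take p ++ V[p] :: (V.drop (p + 1)).take r := by
    rw [show p + r + 1 = p + (r + 1) by omega, List.take_add, List.drop_eq_getElem_cons hp,
      List.take_succ_cons]
  rw [this, List.flatMap_append, List.flatMap_cons]
  simp only [List.length_append]
  omega

theorem flatMap_eq_take_append (V : List A) (p : ℕ) :
    ∃ R, V.flatMap g = (V.take p).flatMap g ++ ((V[p]?).elim [] g ++ R) ∧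
      (V[p]? = none → R = []) := by
  refine ⟨(V.drop (p + 1)).flatMap g, ?_, fun h => ?_⟩
  · conv_lhs => rw [← List.take_append_drop p V, List.flatMap_append]
    congr 1
    by_cases hp : p < V.length
    · rw [List.drop_eq_getElem_cons hp, List.flatMap_cons, List.getElem?_eq_getElem hp]
      rfl
    · rw [List.drop_eq_nil_of_le (by omega), List.drop_eq_nil_of_le (by omega),
        List.getElem?_eq_none (by omega)]
      rfl
  · rw [List.getElem?_eq_none_iff] at h
    rw [List.drop_eq_nil_of_le (by omega)]
    rfl

theorem take_flatMap {V : List A} {p s : ℕ} (hs : IsOffset g V[p]? s) :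
    (V.flatMap g).take (((V.take p).flatMap g).length + s) =
      (V.take p).flatMap g ++ ((V[p]?).elim [] g).take s := by
  obtain ⟨R, hR, -⟩ := flatMap_eq_take_append g V p
  rw [hR, List.take_length_add_append, List.take_append_of_le_length hs.le]

/-- This is why a state contains the letters after the cuts: with the offsets, they determine the
letters after the lifted cuts. -/
theorem getElem?_flatMap {V : List A} {p s : ℕ} (hs : IsOffset g V[p]? s) :
    (V.flatMap g)[((V.take p).flatMap g).length + s]? = ((V[p]?).elim [] g)[s]? := by
  obtain ⟨R, hR, hR'⟩ := flatMap_eq_take_append g V p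
  rw [hR, List.getElem?_append_right (Nat.le_add_right _ _), Nat.add_sub_cancel_left]
  rcases hs with h | ⟨h, -⟩
  · rw [List.getElem?_append_left h]
  · rw [hR' h, List.append_nil]

/-- `p 0 ≤ … ≤ p k` are positions in `W`. -/
def IsCut (k : ℕ) (W : List A) (p : ℕ → ℕ) : Prop :=
  (∀ j < k, p j ≤ p (j + 1)) ∧ ∀ j ≤ k, p j ≤ W.length

/-- The positions `p` in the image of `V` lie over the positions `p'` in `V`, with offsets `s`. -/
def IsLift (k : ℕ) (V : List A) (p' s p : ℕ → ℕ) : Prop :=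
  ∀ j ≤ k, IsOffset g V[p' j]? (s j) ∧ p j = ((V.take (p' j)).flatMap g).length + s j

variable {g}

theorem IsCut.exists_isLift {k : ℕ} {V : List A} {p : ℕ → ℕ} (hp : IsCut k (V.flatMap g) p) :
    ∃ p' s, IsCut k V p' ∧ IsLift g k V p' s p := by
  choose! p' hp' s hs e using fun j (hj : j ≤ k) => exists_isOffset g V (hp.2 j hj)
  refine ⟨p', s, ⟨fun j hj => ?_, hp'⟩, fun j hj => ⟨hs j hj, e j hj⟩⟩
  by_contra! hlt
  have h1 := flatMap_take_lt g hlt (hp' j hj.le) (hs (j + 1) hj)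
  have h2 := hp.1 j hj
  rw [e j hj.le, e (j + 1) hj] at h2
  omega

theorem IsLift.eq_iff {k : ℕ} {V : List A} {p' s p : ℕ → ℕ} (h : IsLift g k V p' s p)
    (hp' : IsCut k V p') {j : ℕ} (hj : j < k) :
    p j = p (j + 1) ↔ p' j = p' (j + 1) ∧ s j = s (j + 1) := by
  have h1 := h j hj.le
  have h2 := h (j + 1) hj
  constructor
  · intro heq
    have : p' j = p' (j + 1) := by
      refine le_antisymm (hp'.1 j hj) (not_lt.1 fun hlt => ?_)
      have := flatMap_take_lt g hlt (hp'.2 _ hj) h1.1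
      omega
    refine ⟨this, ?_⟩
    rw [h1.2, h2.2, this] at heq
    omega
  · rintro ⟨h3, h4⟩
    rw [h1.2, h2.2, h3, h4]

end Cuts

/-! ### Parikh vectors and states of cut words -/

section States

variable {n : ℕ} {g : Fin n → List (Fin n)}

/-- The vector of the numbers of occurrences of the letters. -/
def parikh (w : List (Fin n)) : Fin n → ℤ := fun a => (w.count a : ℤ)

/-- The matrix of the substitution `g`. -/
def substMatrix (g : Fin n → List (Fin n)) : Matrix (Fin n) (Fin n) ℤ :=
  Matrix.of fun a b => ((g b).count a : ℤ)

theorem parikh_append (u v : List (Fin n)) : parikh (u ++ v) = parikh u + parikh v := by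
  ext a; simp [parikh]

theorem sum_map_eq_parikh (f : Fin n → ℤ) (w : List (Fin n)) :
    (w.map f).sum = ∑ c, f c * parikh w c := by
  induction w with
  | nil => simp [parikh]
  | cons b w ih =>
    rw [List.map_cons, List.sum_cons, ih]
    have : ∀ c, parikh (b :: w) c = parikh w c + if c = b then 1 else 0 := fun c => by
      simp only [parikh, List.count_cons, beq_iff_eq, eq_comm (a := b)]
      push_cast
      rfl
    simp only [this, mul_add, Finset.sum_add_distrib]
    simp [add_comm]

theorem parikh_flatMap (w : List (Fin n)) :
    parikh (w.flatMap g) = (substMatrix g).mulVec (parikh w) := by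
  ext a
  rw [Matrix.mulVec, dotProduct, ← sum_map_eq_parikh]
  simp [parikh, List.count_flatMap, substMatrix, Function.comp_def, Nat.cast_list_sum]
  rfl

theorem abs_parikh_le (w : List (Fin n)) (a : Fin n) : |parikh w a| ≤ w.length := by
  rw [parikh, Nat.abs_cast]
  exact_mod_cast List.count_le_length

/-- The second differences of the Parikh vectors of the prefixes. -/
def secondDiff (W : List (Fin n)) (p : ℕ → ℕ) (j : ℕ) : Fin n → ℤ :=
  parikh (W.take (p (j + 2))) - parikh (W.take (p (j + 1))) - parikh (W.take (p (j + 1))) +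
    parikh (W.take (p j))

/-- The part of the second difference that is due to the offsets. -/
def offsetDiff (g : Fin n → List (Fin n)) (o : ℕ → Option (Fin n)) (s : ℕ → ℕ) (j : ℕ) :
    Fin n → ℤ :=
  parikh (((o (j + 2)).elim [] g).take (s (j + 2))) -
    parikh (((o (j + 1)).elim [] g).take (s (j + 1))) -
    parikh (((o (j + 1)).elim [] g).take (s (j + 1))) + parikh (((o j).elim [] g).take (s j))

/-- A prefix of the image is the image of a prefix followed by part of the image of one letter. The
first piece contributes the matrix, the second a bounded error. -/
theorem IsLift.secondDiff_eq {k : ℕ} {V : List (Fin n)} {p' s p : ℕ → ℕ}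
    (h : IsLift g k V p' s p) {j : ℕ} (hj : j + 2 ≤ k) :
    secondDiff (V.flatMap g) p j = (substMatrix g).mulVec (secondDiff V p' j) +
      offsetDiff g (fun i => V[p' i]?) s j := by
  have key : ∀ i ≤ k, parikh ((V.flatMap g).take (p i)) =
      (substMatrix g).mulVec (parikh (V.take (p' i))) +
        parikh (((V[p' i]?).elim [] g).take (s i)) := fun i hi => by
    rw [(h i hi).2, take_flatMap g (h i hi).1, parikh_append, parikh_flatMap]
  simp only [secondDiff, offsetDiff, key _ hj, key (j + 1) (by omega), key j (by omega),
    Matrix.mulVec_add, Matrix.mulVec_sub]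
  abel

theorem abs_offsetDiff_le {ℓ : ℕ} (hl : ∀ b, (g b).length ≤ ℓ) (o : ℕ → Option (Fin n))
    (s : ℕ → ℕ) (j : ℕ) (a : Fin n) : |offsetDiff g o s j a| ≤ 4 * ℓ := by
  have key : ∀ i, |parikh (((o i).elim [] g).take (s i)) a| ≤ ℓ := fun i => by
    refine (abs_parikh_le _ a).trans ?_
    have : ((o i).elim [] g).length ≤ ℓ := by
      cases o i with
      | none => simp
      | some c => exact hl c
    exact_mod_cast (List.length_take_le' _ _).trans this
  have h0 := abs_le.1 (key j)
  have h1 := abs_le.1 (key (j + 1))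
  have h2 := abs_le.1 (key (j + 2))
  simp only [offsetDiff, Pi.add_apply, Pi.sub_apply]
  exact abs_le.2 ⟨by linarith, by linarith⟩

/-- Two cut words have the same letters after the cuts, the same empty blocks and the same second
differences. -/
def SameState (k : ℕ) (W : List (Fin n)) (p : ℕ → ℕ) (V : List (Fin n)) (q : ℕ → ℕ) : Prop :=
  (∀ j ≤ k, W[p j]? = V[q j]?) ∧ (∀ j < k, p j = p (j + 1) ↔ q j = q (j + 1)) ∧
    ∀ j, j + 2 ≤ k → secondDiff W p j = secondDiff V q j

/-- The offsets `s` of the first cut are reused over the second word. They are admissible there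
because the letters after the cuts agree. -/
theorem SameState.lift {k : ℕ} {V V' : List (Fin n)} {p' q' s p : ℕ → ℕ}
    (h : SameState k V p' V' q') (hp' : IsCut k V p') (hq' : IsCut k V' q')
    (hl : IsLift g k V p' s p) (hp : IsCut k (V.flatMap g) p) :
    ∃ q, IsCut k (V'.flatMap g) q ∧ SameState k (V.flatMap g) p (V'.flatMap g) q := by
  have hq : IsLift g k V' q' s fun j => ((V'.take (q' j)).flatMap g).length + s j :=
    fun j hj => ⟨h.1 j hj ▸ (hl j hj).1, rfl⟩
  refine ⟨fun j => ((V'.take (q' j)).flatMap g).length + s j, ⟨fun j hj => ?_, fun j hj => ?_⟩,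
    fun j hj => ?_, fun j hj => ?_, fun j hj => ?_⟩
  · rcases (hq'.1 j hj).lt_or_eq with hlt | heq
    · have := flatMap_take_lt g hlt (hq'.2 _ hj) (hq j hj.le).1
      dsimp only
      omega
    -- With equal base positions the order of the offsets decides; it is read off from the first
    -- word, where the same block is empty.
    · have h1 := hp.1 j hj
      rw [(hl j hj.le).2, (hl (j + 1) hj).2, (h.2.1 j hj).2 heq] at h1
      dsimp only
      rw [heq]
      omega
  · obtain ⟨R, hR, -⟩ := flatMap_eq_take_append g V' (q' j)
    have := (hq j hj).1.le
    rw [hR]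
    simp only [List.length_append]
    omega
  · rw [(hl j hj).2, getElem?_flatMap g (hl j hj).1, getElem?_flatMap g (hq j hj).1, h.1 j hj]
  · rw [hl.eq_iff hp' hj, hq.eq_iff hq' hj, h.2.1 j hj]
  · rw [hl.secondDiff_eq hj, hq.secondDiff_eq hj, h.2.2 j hj]
    simp only [offsetDiff, h.1 _ hj, h.1 (j + 1) (by omega), h.1 j (by omega)]

end States

/-! ### Bounded orbits -/

section Orbits

variable {n : ℕ}

theorem abs_mulVec_le {m : ℕ} (U : Matrix (Fin m) (Fin n) ℤ) (y : Fin n → ℤ) {Y : ℤ}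
    (hy : ∀ b, |y b| ≤ Y) (i : Fin m) : |U.mulVec y i| ≤ (∑ b, |U i b|) * Y := by
  rw [Matrix.mulVec, dotProduct, Finset.sum_mul]
  refine (Finset.abs_sum_le_sum_abs _ _).trans (Finset.sum_le_sum fun b _ => ?_)
  rw [abs_mul]
  exact mul_le_mul_of_nonneg_left (hy b) (abs_nonneg _)

/-- The numerical conditions of a certificate, for the matrix `M` of a substitution. -/
structure HyperbolicCertificate (M B U : Matrix (Fin n) (Fin n) ℤ) (s κ : ℕ) : Prop where
  pos : 1 ≤ s
  inner : ∀ i, 4 * ∑ b, |((s : ℤ) • M - B * (M * M)) i b| ≤ s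
  future : ∀ i, 4 * ∑ b, |B i b| ≤ s
  last : ∀ i, 4 * ∑ b, |((s : ℤ) • M - U * M) i b| ≤ s
  bound : ∀ i, ∑ b, |U i b| ≤ κ * s

/-- Let `X` be the largest absolute value of an entry over all times, attained at time `t`. For `0 <
t < r` the certificate expresses `x t` through its two neighbours, each with weight at most `1/4`,
up to bounded errors, so `X` can be absorbed. At `t = r` the relation `U (x r) = 0` replaces the
missing neighbour, and at `t = 0` the initial bound applies. The final constant is generous. -/
theorem HyperbolicCertificate.orbit_bound {M B U : Matrix (Fin n) (Fin n) ℤ} {s κ : ℕ}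
    (h : HyperbolicCertificate M B U s κ) {L c : ℕ} (hM : ∀ i, ∑ b, |M i b| ≤ L)
    {x e : ℕ → Fin n → ℤ} {r : ℕ} (hx : ∀ t < r, x (t + 1) = M.mulVec (x t) + e t)
    (he : ∀ t i, |e t i| ≤ c) (hx0 : ∀ i, |x 0 i| ≤ 4) (hr : U.mulVec (x r) = 0) :
    ∀ t ≤ r, ∀ i, |x t i| ≤ (2 * (L * c + 2 * c + κ * c + 4) : ℕ) := by
  intro t₀ ht₀ i₀
  obtain ⟨⟨t, i⟩, hti, hmax⟩ := Finset.exists_max_image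
    (Finset.range (r + 1) ×ˢ (Finset.univ : Finset (Fin n))) (fun q => |x q.1 q.2|)
    ⟨(t₀, i₀), by simp; omega⟩
  replace hmax : ∀ t' ≤ r, ∀ i', |x t' i'| ≤ |x t i| := fun t' ht' i' =>
    hmax (t', i') (by simp; omega)
  have ht : t ≤ r := by simp at hti; omega
  refine (hmax t₀ ht₀ i₀).trans ?_
  set X := |x t i| with hX
  have hX0 : 0 ≤ X := abs_nonneg _
  have hs : (1 : ℤ) ≤ s := by exact_mod_cast h.pos
  have hc : (0 : ℤ) ≤ c := by positivity
  have hL : (0 : ℤ) ≤ L := by positivity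
  have hκ : (0 : ℤ) ≤ κ := by positivity
  have hLc := mul_nonneg hL hc
  have hκc := mul_nonneg hκ hc
  push_cast
  rcases Nat.eq_zero_or_pos t with rfl | htpos
  · have := hx0 i
    linarith
  obtain ⟨u, rfl⟩ : ∃ u, t = u + 1 := ⟨t - 1, by omega⟩
  have hxu := hx u (by omega)
  rcases ht.lt_or_eq with hlt | heq
  · have hxu' := hx (u + 1) hlt
    -- The argument of `B.mulVec` is `M * M` applied to `x u`: two steps forward with the errors
    -- removed.
    have key : (s : ℤ) • x (u + 1) = ((s : ℤ) • M - B * (M * M)).mulVec (x u) +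
        B.mulVec (x (u + 2) - M.mulVec (e u) - e (u + 1)) + (s : ℤ) • e u := by
      rw [hxu', hxu]
      simp only [Matrix.sub_mulVec, Matrix.smul_mulVec, Matrix.mulVec_add, Matrix.mulVec_sub,
        smul_add, ← Matrix.mulVec_mulVec]
      abel
    have key' := congrFun key i
    simp only [Pi.smul_apply, Pi.add_apply, smul_eq_mul] at key'
    have b1 := abs_mulVec_le ((s : ℤ) • M - B * (M * M)) (x u) (hmax u (by omega)) i
    have b2 := abs_mulVec_le B (x (u + 2) - M.mulVec (e u) - e (u + 1)) (Y := X + L * c + c)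
      (fun b => by
        have h1 := hmax (u + 2) hlt b
        have h2 := (abs_mulVec_le M (e u) (he u) b).trans
          (mul_le_mul_of_nonneg_right (hM b) hc)
        have h3 := he (u + 1) b
        simp only [Pi.sub_apply]
        rw [abs_le] at *
        constructor <;> linarith) i
    have b3 := he u i
    have b1' := mul_le_mul_of_nonneg_right (h.inner i) hX0
    have b2' := mul_le_mul_of_nonneg_right (h.future i) (show 0 ≤ X + L * c + c by positivity)
    have : s * X ≤ |((s : ℤ) • M - B * (M * M)).mulVec (x u) i| +
        |B.mulVec (x (u + 2) - M.mulVec (e u) - e (u + 1)) i| + s * |e u i| := by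
      rw [hX, ← abs_of_nonneg (show (0 : ℤ) ≤ s by positivity), ← abs_mul, ← abs_mul,
        abs_of_nonneg (show (0 : ℤ) ≤ s by positivity), key']
      exact abs_add_three _ _ _
    have b4 := mul_le_mul_of_nonneg_left b3 (show (0 : ℤ) ≤ s by positivity)
    have : s * (4 * X) ≤ s * (X + (X + L * c + c) + 4 * c) := by linarith
    have := le_of_mul_le_mul_left this (by linarith)
    linarith
  · have key : (s : ℤ) • x (u + 1) = ((s : ℤ) • M - U * M).mulVec (x u) - U.mulVec (e u) +
        (s : ℤ) • e u := by
      have h1 : (U * M).mulVec (x u) = - U.mulVec (e u) := by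
        rw [← heq, hxu, Matrix.mulVec_add, Matrix.mulVec_mulVec] at hr
        exact eq_neg_of_add_eq_zero_left hr
      rw [hxu, Matrix.sub_mulVec, h1, Matrix.smul_mulVec, smul_add]
      abel
    have key' := congrFun key i
    simp only [Pi.smul_apply, Pi.add_apply, Pi.sub_apply, smul_eq_mul] at key'
    have b1 := abs_mulVec_le ((s : ℤ) • M - U * M) (x u) (hmax u (by omega)) i
    have b2 := (abs_mulVec_le U (e u) (he u) i).trans
      (mul_le_mul_of_nonneg_right (h.bound i) hc)
    have b3 := he u i
    have b1' := mul_le_mul_of_nonneg_right (h.last i) hX0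
    have : s * X ≤ |((s : ℤ) • M - U * M).mulVec (x u) i| + |U.mulVec (e u) i| +
        s * |e u i| := by
      rw [hX, ← abs_of_nonneg (show (0 : ℤ) ≤ s by positivity), ← abs_mul, ← abs_mul,
        abs_of_nonneg (show (0 : ℤ) ≤ s by positivity), key']
      exact (abs_add_le _ _).trans (add_le_add_left (abs_sub _ _) _)
    have b4 := mul_le_mul_of_nonneg_left b3 (show (0 : ℤ) ≤ s by positivity)
    have : s * (4 * X) ≤ s * (X + 4 * (κ * c) + 4 * c) := by linarith
    have := le_of_mul_le_mul_left this (by linarith)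
    linarith

end Orbits

/-! ### The first power -/

section Bound

variable {n : ℕ} {g : Fin n → List (Fin n)}

theorem exists_orbit_of_isCut (k : ℕ) (a : Fin n) (i : ℕ) {p : ℕ → ℕ}
    (hp : IsCut k ((List.flatMap g)^[i] [a]) p) :
    ∃ P S : ℕ → ℕ → ℕ, P i = p ∧ (∀ t ≤ i, IsCut k ((List.flatMap g)^[t] [a]) (P t)) ∧
      ∀ t < i, IsLift g k ((List.flatMap g)^[t] [a]) (P t) (S t) (P (t + 1)) := by
  induction i generalizing p with
  | zero =>
    refine ⟨fun _ => p, fun _ => p, rfl, fun t ht => ?_, fun t ht => absurd ht (by omega)⟩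
    obtain rfl : t = 0 := by omega
    exact hp
  | succ i ih =>
    rw [Function.iterate_succ_apply'] at hp
    obtain ⟨p', s, hp', hs⟩ := hp.exists_isLift
    obtain ⟨P, S, hP, hcut, hlift⟩ := ih hp'
    refine ⟨Function.update P (i + 1) p, Function.update S i s, by simp, fun t ht => ?_,
      fun t ht => ?_⟩
    · rcases ht.lt_or_eq with h | rfl
      · rw [Function.update_of_ne (by omega)]
        exact hcut t (by omega)
      · rwa [Function.update_self, Function.iterate_succ_apply']
    · rw [Function.update_of_ne (a := t) (by omega)]
      rcases (Nat.lt_succ_iff.1 ht).lt_or_eq with h | rfl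
      · rw [Function.update_of_ne (by omega), Function.update_of_ne (by omega)]
        exact hlift t h
      · rw [Function.update_self, Function.update_self, hP]
        exact hs

/-- The cut `p` of `W` cuts out a nonempty word, and the second differences satisfy `Q`. -/
def IsGoodCut (k : ℕ) (Q : (Fin n → ℤ) → Prop) (W : List (Fin n)) (p : ℕ → ℕ) : Prop :=
  IsCut k W p ∧ p 0 < p k ∧ ∀ j, j + 2 ≤ k → Q (secondDiff W p j)

theorem eq_of_steps {k : ℕ} {p : ℕ → ℕ} (h : ∀ j < k, p j = p (j + 1)) : p 0 = p k := by
  induction k with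
  | zero => rfl
  | succ k ih => rw [ih fun j hj => h j (by omega), h k (by omega)]

/-- Vanishing second differences cannot tell a nonempty power from `k` empty blocks; the record of
empty blocks in the state does. -/
theorem IsGoodCut.of_sameState {k : ℕ} {Q : (Fin n → ℤ) → Prop} {W V : List (Fin n)}
    {p q : ℕ → ℕ} (h : IsGoodCut k Q W p) (hq : IsCut k V q) (hs : SameState k W p V q) :
    IsGoodCut k Q V q := by
  refine ⟨hq, ?_, fun j hj => hs.2.2 j hj ▸ h.2.2 j hj⟩
  have mono : ∀ m ≤ k, q 0 ≤ q m := fun m hm => by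
    induction m with
    | zero => exact le_rfl
    | succ m ih => exact (ih (by omega)).trans (hq.1 m hm)
  refine (mono k le_rfl).lt_of_ne fun heq => h.2.1.ne (eq_of_steps fun j hj => ?_)
  refine (hs.2.1 j hj).2 ?_
  have mono' : ∀ m, j + 1 + m ≤ k → q (j + 1) ≤ q (j + 1 + m) := fun m hm => by
    induction m with
    | zero => exact le_rfl
    | succ m ih => exact (ih (by omega)).trans (hq.1 (j + 1 + m) hm)
  have h1 := mono j hj.le
  have h2 := mono' (k - (j + 1)) (by omega)
  have h3 := hq.1 j hj
  rw [show j + 1 + (k - (j + 1)) = k by omega] at h2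
  omega

/-- Take the least level `i` carrying a good cut and follow its descent. If `i` exceeded the number
of states, two levels would share a state, and excising the stretch between them would give a good
cut at a smaller level. -/
theorem exists_good_cut_le {Q : (Fin n → ℤ) → Prop} {B U : Matrix (Fin n) (Fin n) ℤ}
    {s κ ℓ : ℕ} (h : HyperbolicCertificate (substMatrix g) B U s κ)
    (hl : ∀ b, (g b).length ≤ ℓ) (hQ : ∀ x, Q x → U.mulVec x = 0) (k : ℕ) (a : Fin n)
    (hex : ∃ i, 1 ≤ i ∧ ∃ p, IsGoodCut k Q ((List.flatMap g)^[i] [a]) p) :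
    ∃ i, 1 ≤ i ∧ i ≤ stateCount n k (diffBound n κ ℓ) ∧
      ∃ p, IsGoodCut k Q ((List.flatMap g)^[i] [a]) p := by
  classical
  set W : ℕ → List (Fin n) := fun i => (List.flatMap g)^[i] [a] with hW
  have hWs : ∀ t, W (t + 1) = (W t).flatMap g := fun t => Function.iterate_succ_apply' _ _ _
  set β := diffBound n κ ℓ with hβ
  obtain ⟨i, ⟨hi, p, hp⟩, hmin⟩ := (⟨_, Nat.find_spec hex, fun m => Nat.find_min' hex⟩ :
    ∃ i, (1 ≤ i ∧ ∃ p, IsGoodCut k Q (W i) p) ∧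
      ∀ m, (1 ≤ m ∧ ∃ p, IsGoodCut k Q (W m) p) → i ≤ m)
  refine ⟨i, hi, ?_, p, hp⟩
  obtain ⟨P, S, hP, hcut, hlift⟩ := exists_orbit_of_isCut k a i hp.1
  change ∀ t ≤ i, IsCut k (W t) (P t) at hcut
  change ∀ t < i, IsLift g k (W t) (P t) (S t) (P (t + 1)) at hlift
  have hM : ∀ i, ∑ b, |substMatrix g i b| ≤ ((n * ℓ : ℕ) : ℤ) := fun i => by
    have : ∀ b ∈ (Finset.univ : Finset (Fin n)), |substMatrix g i b| ≤ (ℓ : ℤ) := fun b _ => by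
      rw [substMatrix, Matrix.of_apply, Nat.abs_cast]
      exact_mod_cast List.count_le_length.trans (hl b)
    refine (Finset.sum_le_card_nsmul _ _ _ this).trans ?_
    simp
  have hbound : ∀ t ≤ i, ∀ j, j + 2 ≤ k → ∀ c, |secondDiff (W t) (P t) j c| ≤ β := by
    intro t ht j hj c
    -- With row sums at most `n * ℓ` and errors at most `4 * ℓ`, the orbit bound is `diffBound n κ
    -- ℓ`.
    refine h.orbit_bound hM (c := 4 * ℓ) (x := fun t => secondDiff (W t) (P t) j)
      (e := fun t => offsetDiff g (fun i => (W t)[P t i]?) (S t) j) (r := i)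
      (fun t ht => ?_) (fun t c => ?_) (fun c => ?_) ?_ t ht c
    · have := (hlift t ht).secondDiff_eq hj
      rwa [← hWs] at this
    · exact_mod_cast abs_offsetDiff_le hl _ _ j c
    · have key : ∀ i, |parikh ((W 0).take (P 0 i)) c| ≤ 1 := fun i =>
        (abs_parikh_le _ c).trans (by
          have : ((W 0).take (P 0 i)).length ≤ (W 0).length := List.length_take_le' _ _
          exact_mod_cast this)
      have h0 := abs_le.1 (key (j + 2))
      have h1 := abs_le.1 (key (j + 1))
      have h2 := abs_le.1 (key j)
      simp only [secondDiff, Pi.add_apply, Pi.sub_apply]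
      exact abs_le.2 ⟨by linarith, by linarith⟩
    · exact hQ _ (hP ▸ hp.2.2 j hj)
  by_contra! hlt
  let F : ℕ → (Fin (k + 1) → Option (Fin n)) × (Fin k → Bool) × (Fin (k - 1) → Fin n → ℤ) :=
    fun t => (fun j => (W t)[P t j]?, fun j => decide (P t j = P t (j + 1)),
      fun j => secondDiff (W t) (P t) j)
  let box : Finset ((Fin (k + 1) → Option (Fin n)) × (Fin k → Bool) ×
      (Fin (k - 1) → Fin n → ℤ)) :=
    Finset.univ ×ˢ Finset.univ ×ˢ Fintype.piFinset fun _ => Fintype.piFinset fun _ =>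
      Finset.Icc (-(β : ℤ)) β
  -- There are `k + 1` letters or ends of word, `k` emptiness bits, and `k - 1` vectors with entries
  -- in `[-β, β]`.
  have hcard : box.card = stateCount n k β := by
    simp only [box, Finset.card_product, Finset.card_univ, Fintype.card_piFinset, stateCount,
      Int.card_Icc, Finset.prod_const, Fintype.card_pi, Fintype.card_option, Fintype.card_fin,
      Fintype.card_bool]
    rw [show ((β : ℤ) + 1 - -(β : ℤ)).toNat = 2 * β + 1 by omega, mul_assoc]
  -- Level `0` is left out so that the shortened orbit still ends at a level at least `1`.
  have hmaps : ∀ t ∈ Finset.Icc 1 i, F t ∈ box := fun t ht => by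
    simp only [box, F, Finset.mem_product, Finset.mem_univ, true_and, Fintype.mem_piFinset,
      Finset.mem_Icc]
    exact fun j c => abs_le.1 (hbound t (Finset.mem_Icc.1 ht).2 j (by omega) c)
  obtain ⟨t₁, ht₁, t₂, ht₂, hne, hF⟩ := Finset.exists_ne_map_eq_of_card_lt_of_maps_to
    (by rw [hcard, Nat.card_Icc]; omega) hmaps
  wlog hlt' : t₁ < t₂ generalizing t₁ t₂
  · exact this t₂ ht₂ t₁ ht₁ hne.symm hF.symm (by omega)
  rw [Finset.mem_Icc] at ht₁ ht₂
  simp only [F, Prod.mk.injEq] at hF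
  have hsame : SameState k (W t₂) (P t₂) (W t₁) (P t₁) := by
    refine ⟨fun j hj => (congrFun hF.1 ⟨j, by omega⟩).symm, fun j hj => ?_, fun j hj =>
      (congrFun hF.2.2 ⟨j, by omega⟩).symm⟩
    have := congrFun hF.2.1 ⟨j, hj⟩
    simpa only [decide_eq_decide] using this.symm
  -- The offsets used after time `t₂` are replayed from time `t₁`.
  have hshift : ∀ r, t₂ + r ≤ i → ∃ q, IsCut k (W (t₁ + r)) q ∧
      SameState k (W (t₂ + r)) (P (t₂ + r)) (W (t₁ + r)) q := by
    intro r
    induction r with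
    | zero => exact fun _ => ⟨P t₁, hcut t₁ ht₁.2, hsame⟩
    | succ r ih =>
      intro hr
      obtain ⟨q, hq, hs⟩ := ih (by omega)
      have := hcut (t₂ + r + 1) hr
      rw [hWs] at this
      have := hs.lift (hcut (t₂ + r) (by omega)) hq (hlift (t₂ + r) (by omega)) this
      rwa [← hWs, ← hWs] at this
  obtain ⟨q, hq, hs⟩ := hshift (i - t₂) (by omega)
  rw [show t₂ + (i - t₂) = i by omega, hP] at hs
  have := hmin (t₁ + (i - t₂)) ⟨by omega, q, hp.of_sameState hq hs⟩
  omega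

end Bound

end PowerFree

namespace PowerFree

/-! ### Existence of certificates -/

section Certificates

open Filter Topology
open scoped ENNReal

variable {n : ℕ}

/-- By Gelfand's formula the norms of the powers are eventually at most `r ^ N`, for some `r < 1`
above the spectral radius. -/
theorem tendsto_pow_zero_of_spectrum {𝒜 : Type*} [NormedRing 𝒜] [NormedAlgebra ℂ 𝒜]
    [CompleteSpace 𝒜] (a : 𝒜) (h : ∀ μ ∈ spectrum ℂ a, ‖μ‖ < 1) :
    Tendsto (fun N : ℕ => a ^ N) atTop (𝓝 0) := by
  have hρ : spectralRadius ℂ a < 1 := by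
    rcases (spectrum ℂ a).eq_empty_or_nonempty with he | hne
    · simp [spectralRadius, he]
    · exact_mod_cast spectrum.spectralRadius_lt_of_forall_lt_of_nonempty hne (r := 1)
        fun k hk => by exact_mod_cast h k hk
  obtain ⟨r, hρr, hr⟩ := exists_between hρ
  have hev := (spectrum.pow_nnnorm_pow_one_div_tendsto_nhds_spectralRadius a).eventually_lt_const
    hρr
  have hle : ∀ᶠ N : ℕ in atTop, (‖a ^ N‖₊ : ℝ≥0∞) ≤ r ^ N := by
    filter_upwards [hev, eventually_ge_atTop 1] with N hN hN1
    have hN0 : (N : ℝ) ≠ 0 := by positivity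
    calc (‖a ^ N‖₊ : ℝ≥0∞) = ((‖a ^ N‖₊ : ℝ≥0∞) ^ (1 / N : ℝ)) ^ N := by
          rw [← ENNReal.rpow_natCast, ← ENNReal.rpow_mul, one_div_mul_cancel hN0, ENNReal.rpow_one]
      _ ≤ r ^ N := pow_le_pow_left' hN.le N
  have h0 : Tendsto (fun N : ℕ => (‖a ^ N‖₊ : ℝ≥0∞)) atTop (𝓝 0) :=
    tendsto_of_tendsto_of_tendsto_of_le_of_le' tendsto_const_nhds
      (ENNReal.tendsto_pow_atTop_nhds_zero_of_lt_one hr) (Eventually.of_forall fun _ => zero_le)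
      hle
  rw [tendsto_zero_iff_norm_tendsto_zero]
  have h1 : Tendsto (fun N : ℕ => ‖a ^ N‖₊) atTop (𝓝 0) := ENNReal.tendsto_coe.1 h0
  exact NNReal.tendsto_coe.2 h1

theorem tendsto_pow_apply {X : Matrix (Fin n) (Fin n) ℂ}
    (h : ∀ μ, Module.End.HasEigenvalue (Matrix.toLin' X) μ → ‖μ‖ < 1) (i j : Fin n) :
    Tendsto (fun N : ℕ => (X ^ N) i j) atTop (𝓝 0) := by
  let _ := Matrix.linftyOpNormedRing (n := Fin n) (α := ℂ)
  let _ := Matrix.linftyOpNormedAlgebra (n := Fin n) (R := ℂ) (α := ℂ)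
  have : CompleteSpace (Matrix (Fin n) (Fin n) ℂ) := FiniteDimensional.complete ℂ _
  have := tendsto_pow_zero_of_spectrum X fun μ hμ => h μ (by
    rw [Module.End.hasEigenvalue_iff_mem_spectrum, Matrix.spectrum_toLin']
    exact hμ)
  exact ((continuous_apply_apply i j).tendsto (0 : Matrix (Fin n) (Fin n) ℂ)).comp this

/-- The sum of the generalized eigenspaces of the eigenvalues of modulus at most `1`. -/
def contractingEigenspace (f : Module.End ℂ (Fin n → ℂ)) : Submodule ℂ (Fin n → ℂ) :=
  ⨆ (μ : ℂ) (_ : ‖μ‖ ≤ 1), f.maxGenEigenspace μ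

theorem isCompl_eigenspaces (f : Module.End ℂ (Fin n → ℂ)) :
    IsCompl (expandingEigenspace f) (contractingEigenspace f) := by
  constructor
  · exact f.independent_maxGenEigenspace.disjoint_biSup_biSup
      (s := {μ : ℂ | 1 < ‖μ‖}) (t := {μ : ℂ | ‖μ‖ ≤ 1})
      (Set.disjoint_left.2 fun μ (h1 : 1 < ‖μ‖) (h2 : ‖μ‖ ≤ 1) => not_lt.2 h2 h1)
  · rw [codisjoint_iff, eq_top_iff, ← Module.End.iSup_maxGenEigenspace_eq_top f]
    refine iSup_le fun μ => ?_
    rcases lt_or_ge 1 ‖μ‖ with h | h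
    · exact (le_iSup₂_of_le (f := fun (μ : ℂ) (_ : 1 < ‖μ‖) => f.maxGenEigenspace μ) μ h
        le_rfl).trans le_sup_left
    · exact (le_iSup₂_of_le (f := fun (μ : ℂ) (_ : ‖μ‖ ≤ 1) => f.maxGenEigenspace μ) μ h
        le_rfl).trans le_sup_right

theorem apply_mem_iSup_maxGenEigenspace (f : Module.End ℂ (Fin n → ℂ)) (p : ℂ → Prop)
    {x : Fin n → ℂ} (hx : x ∈ ⨆ (μ : ℂ) (_ : p μ), f.maxGenEigenspace μ) :
    f x ∈ ⨆ (μ : ℂ) (_ : p μ), f.maxGenEigenspace μ := by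
  have : (⨆ (μ : ℂ) (_ : p μ), f.maxGenEigenspace μ) ≤
      (⨆ (μ : ℂ) (_ : p μ), f.maxGenEigenspace μ).comap f :=
    iSup₂_le fun μ hμ y hy => (le_iSup₂_of_le (f := fun (μ : ℂ) (_ : p μ) =>
      f.maxGenEigenspace μ) μ hμ le_rfl) (f.mapsTo_maxGenEigenspace_of_comm (Commute.refl f) μ hy)
  exact this hx

/-- A hyperbolic endomorphism is the sum of a contraction and of a map that is inverted by a
contraction. -/
theorem exists_contractions (f : Module.End ℂ (Fin n → ℂ))
    (hf : ∀ μ, f.HasEigenvalue μ → ‖μ‖ ≠ 1) :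
    ∃ q r : Module.End ℂ (Fin n → ℂ), (∀ μ, q.HasEigenvalue μ → ‖μ‖ < 1) ∧
      (∀ μ, r.HasEigenvalue μ → ‖μ‖ < 1) ∧
      ∀ N, 1 ≤ N → f ^ N = q ^ N + r ^ N * (f ^ N * f ^ N) ∧
        ∀ x, (f ^ N - q ^ N) x ∈ expandingEigenspace f := by
  set E := expandingEigenspace f with hE
  set C := contractingEigenspace f with hC
  have hEC : IsCompl E C := isCompl_eigenspaces f
  have hfE : ∀ x ∈ E, f x ∈ E := fun x hx => apply_mem_iSup_maxGenEigenspace f _ hx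
  have hfC : ∀ x ∈ C, f x ∈ C := fun x hx => apply_mem_iSup_maxGenEigenspace f _ hx
  have hEig : ∀ (μ : ℂ) (x : Fin n → ℂ), f x = μ • x → (1 < ‖μ‖ → x ∈ E) ∧ (‖μ‖ ≤ 1 → x ∈ C) := by
    intro μ x hx
    have hx' : x ∈ f.maxGenEigenspace μ := by
      refine (f.genEigenspace μ).monotone (le_top : (1 : ℕ∞) ≤ ⊤) ?_
      exact Module.End.mem_eigenspace_iff.2 hx
    exact ⟨fun h => (le_iSup₂_of_le (f := fun (μ : ℂ) (_ : 1 < ‖μ‖) => f.maxGenEigenspace μ) μ h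
      le_rfl) hx', fun h => (le_iSup₂_of_le (f := fun (μ : ℂ) (_ : ‖μ‖ ≤ 1) =>
        f.maxGenEigenspace μ) μ h le_rfl) hx'⟩
  have hEC0 : ∀ x, x ∈ E → x ∈ C → x = 0 := fun x h1 h2 =>
    Submodule.disjoint_def.1 hEC.disjoint x h1 h2
  let P : Module.End ℂ (Fin n → ℂ) := E.projection C hEC
  have hPE : ∀ x ∈ E, P x = x := fun x hx => Submodule.projection_apply_of_mem_left hEC hx
  have hPC : ∀ x ∈ C, P x = 0 := fun x hx => (Submodule.projection_apply_eq_zero_iff hEC).2 hx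
  have hPm : ∀ x, P x ∈ E := fun x => Submodule.projection_apply_mem hEC x
  have hPs : ∀ x, x - P x ∈ C := fun x => Submodule.sub_projection_mem hEC x
  have hPf : ∀ x, P (f x) = f (P x) := fun x => by
    have : f x = f (P x) + f (x - P x) := by rw [← map_add]; congr 1; abel
    rw [this, map_add, hPE _ (hfE _ (hPm x)), hPC _ (hfC _ (hPs x)), add_zero]
  let fE : Module.End ℂ E := f.restrict hfE
  have hinj : Function.Injective fE := by
    rw [injective_iff_map_eq_zero]
    intro x hx
    have h0 : f x = (0 : ℂ) • (x : Fin n → ℂ) := by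
      rw [zero_smul]
      exact congrArg Subtype.val hx
    exact Subtype.ext (hEC0 x x.2 ((hEig 0 x h0).2 (by simp)))
  let eE : E ≃ₗ[ℂ] E := LinearEquiv.ofInjectiveEndo fE hinj
  -- The inverse of `f` on `E`, extended by zero on `C`.
  let r : Module.End ℂ (Fin n → ℂ) := E.subtype ∘ₗ eE.symm.toLinearMap ∘ₗ E.projectionOnto C hEC
  have hr : ∀ x, r x = (eE.symm (E.projectionOnto C hEC x) : Fin n → ℂ) := fun x => rfl
  have hrm : ∀ x, r x ∈ E := fun x => (eE.symm (E.projectionOnto C hEC x)).2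
  have hfr : ∀ x, f (r x) = P x := fun x => by
    have : eE (eE.symm (E.projectionOnto C hEC x)) = E.projectionOnto C hEC x :=
      LinearEquiv.apply_symm_apply _ _
    exact congrArg Subtype.val this
  have hfinj : ∀ x ∈ E, f x = 0 → x = 0 := fun x hx h0 =>
    hEC0 x hx ((hEig 0 x (by rw [h0, zero_smul])).2 (by simp))
  have hrf : ∀ x, r (f x) = P x := fun x => by
    refine sub_eq_zero.1 (hfinj _ (E.sub_mem (hrm _) (hPm _)) ?_)
    rw [map_sub, hfr, hPf, sub_self]
  have cPf : P * f = f * P := LinearMap.ext hPf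
  have cfr : f * r = P := LinearMap.ext hfr
  have crf : r * f = P := LinearMap.ext hrf
  have hPP : IsIdempotentElem P := LinearMap.ext fun x => hPE _ (hPm x)
  have hPN : ∀ N, 1 ≤ N → P ^ N = P := fun N hN => by
    obtain ⟨m, rfl⟩ := Nat.exists_eq_add_of_le' hN
    exact hPP.pow_succ_eq m
  have hQN : ∀ N, 1 ≤ N → (1 - P) ^ N = 1 - P := fun N hN => by
    obtain ⟨m, rfl⟩ := Nat.exists_eq_add_of_le' hN
    exact hPP.one_sub.pow_succ_eq m
  have hqN : ∀ N, 1 ≤ N → (f * (1 - P)) ^ N = f ^ N - P * f ^ N := fun N hN => by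
    have c1 : Commute f (1 - P) := (Commute.one_right f).sub_right cPf.symm
    have c2 : Commute P (f ^ N) := Commute.pow_right cPf N
    rw [c1.mul_pow, hQN N hN, mul_sub, mul_one, c2.eq]
  refine ⟨f * (1 - P), r, fun μ hμ => ?_, fun μ hμ => ?_, fun N hN => ⟨?_, fun x => ?_⟩⟩
  · obtain ⟨v, hv⟩ := hμ.exists_hasEigenvector
    -- If `1 ≤ ‖μ‖`, then `P v = 0` and `v` is an eigenvector of `f`. As `‖μ‖ ≠ 1`, it lies in `E`,
    -- where `P` is the identity, so `v = 0`.
    have hv1 : f (v - P v) = μ • v := hv.apply_eq_smul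
    by_contra! hle
    have hμ0 : μ ≠ 0 := fun h => by simp [h] at hle; linarith
    have hPv : P v = 0 := by
      have : P (f (v - P v)) = 0 := hPC _ (hfC _ (hPs v))
      rw [hv1, map_smul, smul_eq_zero] at this
      exact this.resolve_left hμ0
    rw [hPv, sub_zero] at hv1
    have hne := hf μ (Module.End.hasEigenvalue_of_hasEigenvector
      ⟨Module.End.mem_eigenspace_iff.2 hv1, hv.2⟩)
    have := hPE v ((hEig μ v hv1).1 (lt_of_le_of_ne hle hne.symm))
    exact hv.2 (this.symm.trans hPv)
  · obtain ⟨v, hv⟩ := hμ.exists_hasEigenvector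
    -- If `1 ≤ ‖μ‖`, then `v` lies in `E` and is an eigenvector of `f` for `μ⁻¹`, so it lies in `C`
    -- as well.
    have hv1 : r v = μ • v := hv.apply_eq_smul
    by_contra! hle
    have hμ0 : μ ≠ 0 := fun h => by simp [h] at hle; linarith
    have hvE : v ∈ E := by
      have := E.smul_mem μ⁻¹ (hrm v)
      rwa [hv1, inv_smul_smul₀ hμ0] at this
    have hv2 : f v = μ⁻¹ • v := by
      have := hfr v
      rw [hv1, map_smul, hPE v hvE] at this
      rw [← this, inv_smul_smul₀ hμ0, this]
    exact hv.2 (hEC0 v hvE ((hEig μ⁻¹ v hv2).2 (by rw [norm_inv]; exact inv_le_one_of_one_le₀ hle)))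
  · have c3 : Commute r f := crf.trans cfr.symm
    rw [hqN N hN, ← mul_assoc, ← c3.mul_pow, crf, hPN N hN, sub_add_cancel]
  · rw [hqN N hN, sub_sub_cancel]
    exact hPm _

theorem tendsto_floor_mul_div (b : ℝ) :
    Tendsto (fun s : ℕ => (⌊(s : ℝ) * b⌋ : ℝ) / s) atTop (𝓝 b) := by
  refine tendsto_of_tendsto_of_tendsto_of_le_of_le' (g := fun s : ℕ => b - 1 / (s : ℝ))
    (h := fun _ => b) ?_ tendsto_const_nhds ?_ ?_
  · simpa using tendsto_const_nhds.sub (tendsto_one_div_atTop_nhds_zero_nat (𝕜 := ℝ))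
  · filter_upwards [eventually_ge_atTop 1] with s hs
    have hs' : (0 : ℝ) < s := by positivity
    rw [le_div_iff₀ hs', sub_mul, one_div_mul_cancel hs'.ne', mul_comm b]
    exact (Int.sub_one_lt_floor _).le
  · filter_upwards [eventually_ge_atTop 1] with s hs
    have hs' : (0 : ℝ) < s := by positivity
    rw [div_le_iff₀ hs', mul_comm b]
    exact Int.floor_le _

/-- The numerators of an approximation of the real part of `X` with denominator `s`. -/
noncomputable def floorMatrix {m : ℕ} (X : Matrix (Fin n) (Fin m) ℂ) (s : ℕ) : Matrix (Fin n) (Fin m) ℤ :=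
  Matrix.of fun i j => ⌊(s : ℝ) * (X i j).re⌋

/-- The strict inequality leaves room for rounding when `s` is large. As `M` and `Y` are real,
replacing `X` by its real part does not increase the error. -/
theorem eventually_floorMatrix {m l : ℕ} (X : Matrix (Fin n) (Fin m) ℂ)
    (M : Matrix (Fin n) (Fin l) ℤ) (Y : Matrix (Fin m) (Fin l) ℤ) (i : Fin n)
    (h : 4 * ∑ b, ‖(M.map (Int.cast : ℤ → ℂ) - X * Y.map (Int.cast : ℤ → ℂ)) i b‖ < 1) :
    ∀ᶠ s : ℕ in atTop, 4 * ∑ b, |((s : ℤ) • M - floorMatrix X s * Y) i b| ≤ (s : ℤ) := by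
  have hlim : Tendsto (fun s : ℕ => 4 * ∑ b, |(M i b : ℝ) -
      ∑ c, ((⌊(s : ℝ) * (X i c).re⌋ : ℝ) / s) * (Y c b : ℝ)|) atTop
      (𝓝 (4 * ∑ b, |(M i b : ℝ) - ∑ c, (X i c).re * (Y c b : ℝ)|)) := by
    refine (tendsto_finsetSum _ fun b _ => Tendsto.abs (tendsto_const_nhds.sub
      (tendsto_finsetSum _ fun c _ => (tendsto_floor_mul_div _).mul_const _))).const_mul 4
  have hlt : 4 * ∑ b, |(M i b : ℝ) - ∑ c, (X i c).re * (Y c b : ℝ)| < 1 := by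
    refine lt_of_le_of_lt (mul_le_mul_of_nonneg_left (Finset.sum_le_sum fun b _ => ?_)
      (by norm_num)) h
    refine le_trans (le_of_eq ?_) (Complex.abs_re_le_norm _)
    congr 1
    simp [Matrix.mul_apply]
  filter_upwards [hlim.eventually_lt_const hlt, eventually_ge_atTop 1] with s hs hs1
  have hs' : (0 : ℝ) < s := by positivity
  have key : ∀ b, ((|((s : ℤ) • M - floorMatrix X s * Y) i b| : ℤ) : ℝ) =
      s * |(M i b : ℝ) - ∑ c, ((⌊(s : ℝ) * (X i c).re⌋ : ℝ) / s) * (Y c b : ℝ)| := fun b => by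
    rw [Int.cast_abs, ← abs_of_pos hs', ← abs_mul, abs_of_pos hs']
    congr 1
    simp only [Matrix.sub_apply, Matrix.smul_apply, Matrix.mul_apply, floorMatrix,
      Matrix.of_apply, smul_eq_mul, mul_sub, Finset.mul_sum]
    push_cast
    congr 1
    refine Finset.sum_congr rfl fun c _ => ?_
    field_simp
  have : ((4 * ∑ b, |((s : ℤ) • M - floorMatrix X s * Y) i b| : ℤ) : ℝ) ≤ ((s : ℤ) : ℝ) := by
    rw [Int.cast_mul, Int.cast_sum, Finset.sum_congr rfl fun b _ => key b, ← Finset.mul_sum]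
    push_cast
    nlinarith
  exact_mod_cast this

/-- Let `Q`, `R` be the matrices of the two contractions and `T` that of a left inverse of `Φ` on
`E`. Then `M^N - R^N M^(2N) = Q^N`. Since `M^N - Q^N` maps into `E`, where `T Φ` is the identity,
also `M^N - T Φ M^N = Q^N - T Φ Q^N`. These matrices and `R^N` tend to `0`, so a large `N` followed
by a large denominator `s` works. -/
theorem exists_hyperbolicCertificate {d : ℕ} (M : Matrix (Fin n) (Fin n) ℤ)
    (Φ : Matrix (Fin d) (Fin n) ℤ)
    (hM : ∀ μ : ℂ, Module.End.HasEigenvalue (Matrix.toLin' (M.map (Int.cast : ℤ → ℂ))) μ → ‖μ‖ ≠ 1)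
    (hΦ : expandingEigenspace (Matrix.toLin' (M.map (Int.cast : ℤ → ℂ))) ⊓
      LinearMap.ker (Matrix.toLin' (Φ.map (Int.cast : ℤ → ℂ))) = ⊥) :
    ∃ N, 1 ≤ N ∧ ∃ (B : Matrix (Fin n) (Fin n) ℤ) (T : Matrix (Fin n) (Fin d) ℤ) (s κ : ℕ),
      HyperbolicCertificate (M ^ N) B (T * Φ) s κ := by
  set Mc := M.map (Int.cast : ℤ → ℂ) with hMc
  set Φc := Φ.map (Int.cast : ℤ → ℂ) with hΦc
  obtain ⟨q, r, hq, hr, hN⟩ := exists_contractions (Matrix.toLin' Mc) hM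
  set E := expandingEigenspace (Matrix.toLin' Mc)
  obtain ⟨ψ, hψ⟩ := LinearMap.exists_leftInverse_of_injective ((Matrix.toLin' Φc).domRestrict E) (by
    rw [LinearMap.ker_eq_bot']
    intro x hx
    have : (x : Fin n → ℂ) ∈ E ⊓ LinearMap.ker (Matrix.toLin' Φc) := ⟨x.2, hx⟩
    rw [hΦ] at this
    exact Subtype.ext this)
  let τ : (Fin d → ℂ) →ₗ[ℂ] (Fin n → ℂ) := E.subtype ∘ₗ ψ
  have hτ : ∀ x ∈ E, τ (Matrix.toLin' Φc x) = x := fun x hx =>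
    congrArg Subtype.val (LinearMap.congr_fun hψ ⟨x, hx⟩)
  set Q := LinearMap.toMatrix' q with hQ
  set R := LinearMap.toMatrix' r with hR
  set T := LinearMap.toMatrix' τ with hT
  have toLin_pow : ∀ (X : Matrix (Fin n) (Fin n) ℂ) (N : ℕ),
      Matrix.toLin' (X ^ N) = Matrix.toLin' X ^ N := fun X N =>
    map_pow (Matrix.toLinAlgEquiv' (R := ℂ) (n := Fin n)) X N
  have hQl : Matrix.toLin' Q = q := Matrix.toLin'_toMatrix' q
  have hRl : Matrix.toLin' R = r := Matrix.toLin'_toMatrix' r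
  have hTl : Matrix.toLin' T = τ := Matrix.toLin'_toMatrix' τ
  have e1 : ∀ N, 1 ≤ N → Mc ^ N - R ^ N * (Mc ^ N * Mc ^ N) = Q ^ N := fun N h => by
    apply Matrix.toLin'.injective
    rw [map_sub, Matrix.toLin'_mul, Matrix.toLin'_mul]
    simp only [toLin_pow, hQl, hRl]
    exact sub_eq_of_eq_add (hN N h).1
  have e2 : ∀ N, 1 ≤ N → Mc ^ N - T * (Φc * Mc ^ N) = Q ^ N - (T * Φc) * Q ^ N := fun N h => by
    apply Matrix.toLin'.injective
    rw [map_sub, map_sub, Matrix.toLin'_mul, Matrix.toLin'_mul, Matrix.toLin'_mul,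
      Matrix.toLin'_mul]
    simp only [toLin_pow, hQl, hTl]
    ext1 x
    have := hτ _ ((hN N h).2 (Pi.single x 1))
    ext y
    simp only [LinearMap.sub_apply, map_sub, LinearMap.comp_apply, LinearMap.coe_single] at this ⊢
    have := congrFun this y
    simp only [Pi.sub_apply] at this ⊢
    linear_combination -this
  have lim1 : ∀ i b, Tendsto (fun N : ℕ => (Q ^ N) i b) atTop (𝓝 0) :=
    tendsto_pow_apply (by rw [hQl]; exact hq)
  have lim2 : ∀ i b, Tendsto (fun N : ℕ => (R ^ N) i b) atTop (𝓝 0) :=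
    tendsto_pow_apply (by rw [hRl]; exact hr)
  have lim3 : ∀ i b, Tendsto (fun N : ℕ => (Q ^ N - (T * Φc) * Q ^ N) i b) atTop (𝓝 0) := by
    intro i b
    simp only [Matrix.sub_apply, Matrix.mul_apply (N := Q ^ _)]
    simpa using (lim1 i b).sub (tendsto_finsetSum Finset.univ fun c _ =>
      (lim1 c b).const_mul ((T * Φc) i c))
  have small : ∀ {F : ℕ → Matrix (Fin n) (Fin n) ℂ},
      (∀ i b, Tendsto (fun N => F N i b) atTop (𝓝 0)) →
      ∀ᶠ N in atTop, ∀ i, 4 * ∑ b, ‖F N i b‖ < 1 := fun {F} hF => by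
    rw [eventually_all]
    intro i
    have : Tendsto (fun N => 4 * ∑ b, ‖F N i b‖) atTop (𝓝 (4 * ∑ _b : Fin n, ‖(0 : ℂ)‖)) :=
      (tendsto_finsetSum _ fun b _ => (hF i b).norm).const_mul 4
    exact this.eventually_lt_const (by simp)
  obtain ⟨N, h1, h2, h3, hN1⟩ := ((small lim1).and ((small lim2).and ((small lim3).and
    (eventually_ge_atTop 1)))).exists
  have mapPow : (M ^ N).map (Int.cast : ℤ → ℂ) = Mc ^ N := map_pow (Int.castRingHom ℂ).mapMatrix M N
  have mapMul : (Φ * M ^ N).map (Int.cast : ℤ → ℂ) = Φc * Mc ^ N := by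
    rw [← mapPow]
    exact Matrix.map_mul (f := Int.castRingHom ℂ)
  have s1 : ∀ᶠ s : ℕ in atTop, ∀ i,
      4 * ∑ b, |((s : ℤ) • (M ^ N) - floorMatrix (R ^ N) s * (M ^ N * M ^ N)) i b| ≤ (s : ℤ) := by
    rw [eventually_all]
    refine fun i => eventually_floorMatrix _ _ _ i ?_
    rw [Matrix.map_mul_intCast, mapPow, e1 N hN1]
    exact h1 i
  -- The rounding lemma with the matrices `0` and `1` bounds the rounded `R ^ N` itself.
  have s2 : ∀ᶠ s : ℕ in atTop, ∀ i,
      4 * ∑ b, |((s : ℤ) • (0 : Matrix (Fin n) (Fin n) ℤ) - floorMatrix (R ^ N) s *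
        (1 : Matrix (Fin n) (Fin n) ℤ)) i b| ≤
        (s : ℤ) := by
    rw [eventually_all]
    refine fun i => eventually_floorMatrix _ _ _ i ?_
    rw [Matrix.map_one _ Int.cast_zero Int.cast_one, mul_one, Matrix.map_zero _ Int.cast_zero,
      zero_sub]
    simpa using h2 i
  have s3 : ∀ᶠ s : ℕ in atTop, ∀ i,
      4 * ∑ b, |((s : ℤ) • (M ^ N) - floorMatrix T s * (Φ * M ^ N)) i b| ≤ (s : ℤ) := by
    rw [eventually_all]
    refine fun i => eventually_floorMatrix _ _ _ i ?_
    rw [mapMul, mapPow, e2 N hN1]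
    exact h3 i
  obtain ⟨s, c1, c2, c3, hs⟩ := (s1.and (s2.and (s3.and (eventually_ge_atTop 1)))).exists
  refine ⟨N, hN1, floorMatrix (R ^ N) s, floorMatrix T s, s,
    -- No particular size of `κ` is needed; since `1 ≤ s`, the sum of all absolute values is large
    -- enough.
    ∑ i, ∑ b, ((floorMatrix T s * Φ) i b).natAbs, hs, c1, fun i => ?_, fun i => ?_, fun i => ?_⟩
  · simpa using c2 i
  · rw [Matrix.mul_assoc]
    exact c3 i
  · push_cast
    have h0 : ∑ b, |(floorMatrix T s * Φ) i b| ≤ ∑ i, ∑ b, |(floorMatrix T s * Φ) i b| :=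
      Finset.single_le_sum (f := fun i => ∑ b, |(floorMatrix T s * Φ) i b|)
        (fun _ _ => Finset.sum_nonneg fun _ _ => abs_nonneg _) (Finset.mem_univ i)
    refine h0.trans (le_mul_of_one_le_right ?_ (by exact_mod_cast hs))
    exact Finset.sum_nonneg fun _ _ => Finset.sum_nonneg fun _ _ => abs_nonneg _

end Certificates

end PowerFree

namespace PowerFree

/-! ### Tables -/

section Tables

variable {n : ℕ}

/-- The table of the images of the letters. -/
def tableOf (g : Fin n → List (Fin n)) : List (List ℕ) := List.ofFn fun a => (g a).map Fin.val

/-- The list of the rows of a matrix. -/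
def rowsOf {m : ℕ} (X : Fin n → Fin m → ℤ) : List (List ℤ) := List.ofFn fun i => List.ofFn (X i)

/-- The matrix with given rows. -/
def matrixOf (n m : ℕ) (U : List (List ℤ)) : Matrix (Fin n) (Fin m) ℤ :=
  Matrix.of fun i j => matEntry U i j

theorem getD_ofFn {α : Type*} (f : Fin n → α) (i : Fin n) (x : α) :
    (List.ofFn f).getD i x = f i := by
  rw [List.getD_eq_getElem _ _ (by simp)]
  simp

theorem matEntry_rowsOf {m : ℕ} (X : Fin n → Fin m → ℤ) (i : Fin n) (j : Fin m) :
    matEntry (rowsOf X) i j = X i j := by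
  rw [matEntry, rowsOf, getD_ofFn, getD_ofFn]

theorem matEntry_range (f : ℕ → ℕ → ℤ) (i j : Fin n) :
    matEntry ((List.range n).map fun i => (List.range n).map (f i)) i j = f i j := by
  simp [matEntry]

theorem sum_map_range {α : Type*} [AddCommMonoid α] (f : ℕ → α) (m : ℕ) :
    ((List.range m).map f).sum = ∑ i : Fin m, f i := by
  rw [← Finset.sum_range]
  induction m with
  | zero => rfl
  | succ m ih => rw [List.sum_range_succ, Finset.sum_range_succ, ih]

theorem absRowSum_eq (U : List (List ℤ)) (i : Fin n) :
    (absRowSum n U i : ℤ) = ∑ b, |matrixOf n n U i b| := by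
  rw [absRowSum, sum_map_range]
  push_cast
  rfl

theorem getD_tableOf (g : Fin n → List (Fin n)) (a : Fin n) :
    (tableOf g).getD a [] = (g a).map Fin.val := getD_ofFn _ _ _

theorem substWord_tableOf (g : Fin n → List (Fin n)) (w : List (Fin n)) :
    substWord (tableOf g) (w.map Fin.val) = (w.flatMap g).map Fin.val := by
  rw [substWord, List.flatMap_map, List.map_flatMap]
  exact List.flatMap_congr fun a _ => getD_tableOf g a

theorem substWord_iterate_tableOf (g : Fin n → List (Fin n)) (i : ℕ) (w : List (Fin n)) :
    (substWord (tableOf g))^[i] (w.map Fin.val) = ((List.flatMap g)^[i] w).map Fin.val := by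
  induction i generalizing w with
  | zero => rfl
  | succ i ih =>
    rw [Function.iterate_succ_apply, Function.iterate_succ_apply, substWord_tableOf, ih]

/-- The iterates of a substitution. -/
def iterSubst (g : Fin n → List (Fin n)) (N : ℕ) : Fin n → List (Fin n) :=
  fun a => (List.flatMap g)^[N] [a]

theorem iterTable_tableOf (g : Fin n → List (Fin n)) (N : ℕ) :
    iterTable (tableOf g) N = tableOf (iterSubst g N) := by
  apply List.ext_getElem
  · simp [iterTable, tableOf]
  · intro i h1 h2
    have hi : i < n := by simpa [tableOf] using h2
    have := substWord_iterate_tableOf g N [⟨i, hi⟩]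
    simpa [iterTable, tableOf, iterSubst] using this

theorem flatMap_iterSubst (g : Fin n → List (Fin n)) (N : ℕ) (w : List (Fin n)) :
    w.flatMap (iterSubst g N) = (List.flatMap g)^[N] w := by
  induction N generalizing w with
  | zero => exact List.flatMap_singleton' w
  | succ N ih =>
    have : iterSubst g (N + 1) = fun a => (iterSubst g N a).flatMap g := by
      funext a
      exact Function.iterate_succ_apply' _ _ _
    rw [this, Function.iterate_succ_apply', ← ih, List.flatMap_assoc]

theorem flatMap_iterSubst_iterate (g : Fin n → List (Fin n)) (N i : ℕ) (w : List (Fin n)) :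
    (List.flatMap (iterSubst g N))^[i] w = (List.flatMap g)^[N * i] w := by
  rw [Function.iterate_mul]
  congr 1
  funext v
  exact flatMap_iterSubst g N v

theorem substMatrix_iterSubst (g : Fin n → List (Fin n)) (N : ℕ) :
    substMatrix (iterSubst g N) = substMatrix g ^ N := by
  induction N with
  | zero =>
    ext a b
    simp [substMatrix, iterSubst, Matrix.one_apply, List.count_singleton, eq_comm (a := a)]
  | succ N ih =>
    ext a b
    rw [pow_succ', ← ih, Matrix.mul_apply]
    have : iterSubst g (N + 1) b = (iterSubst g N b).flatMap g :=
      Function.iterate_succ_apply' _ _ _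
    have h2 := congrFun (parikh_flatMap (g := g) (iterSubst g N b)) a
    rw [← this] at h2
    exact h2

theorem matrixOf_residualTable (s : ℕ) (g v : Fin n → List (Fin n)) (U : List (List ℤ)) :
    matrixOf n n (residualTable n s (tableOf g) (tableOf v) U) =
      (s : ℤ) • substMatrix g - matrixOf n n U * substMatrix v := by
  ext i b
  rw [matrixOf, Matrix.of_apply, residualTable, matEntry_range, getD_tableOf, getD_tableOf,
    List.count_map_of_injective _ _ Fin.val_injective, List.map_map]
  have := sum_map_eq_parikh (fun c => matEntry U i c) (v b)
  rw [Matrix.sub_apply, Matrix.smul_apply, Matrix.mul_apply]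
  exact congrArg (_ - ·) this

theorem matrixOf_mulTable {d : ℕ} (T : List (List ℤ)) (Φ : Matrix (Fin d) (Fin n) ℤ) :
    matrixOf n n (mulTable n d T (rowsOf fun a t => Φ t a)) = matrixOf n d T * Φ := by
  ext i c
  rw [matrixOf, Matrix.of_apply, mulTable, matEntry_range, sum_map_range, Matrix.mul_apply]
  exact Finset.sum_congr rfl fun t _ => by rw [matEntry_rowsOf]; rfl

theorem certifiesTable_iff {d s κ ℓ : ℕ} (g : Fin n → List (Fin n)) (Φ : Matrix (Fin d) (Fin n) ℤ)
    (B T : List (List ℤ)) :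
    CertifiesTable n d s κ ℓ (tableOf g) (rowsOf fun a t => Φ t a) B T ↔
      (∀ b, (g b).length ≤ ℓ) ∧
        HyperbolicCertificate (substMatrix g) (matrixOf n n B) (matrixOf n d T * Φ) s κ := by
  have h2 : substMatrix (iterSubst g 2) = substMatrix g * substMatrix g := by
    rw [substMatrix_iterSubst, pow_two]
  have e1 : ∀ i : Fin n, 4 * absRowSum n (residualTable n s (tableOf g)
      (iterTable (tableOf g) 2) B) i ≤ s ↔ 4 * ∑ b, |((s : ℤ) • substMatrix g -
        matrixOf n n B * (substMatrix g * substMatrix g)) i b| ≤ s := fun i => by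
    rw [iterTable_tableOf, ← h2, ← matrixOf_residualTable, ← absRowSum_eq]
    norm_cast
  have e2 : ∀ i : Fin n, 4 * absRowSum n B i ≤ s ↔ 4 * ∑ b, |matrixOf n n B i b| ≤ s :=
    fun i => by
      rw [← absRowSum_eq]
      norm_cast
  have e3 : ∀ i : Fin n, 4 * absRowSum n (residualTable n s (tableOf g) (tableOf g)
      (mulTable n d T (rowsOf fun a t => Φ t a))) i ≤ s ↔ 4 * ∑ b, |((s : ℤ) • substMatrix g -
        (matrixOf n d T * Φ) * substMatrix g) i b| ≤ s := fun i => by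
    rw [← matrixOf_mulTable, ← matrixOf_residualTable, ← absRowSum_eq]
    norm_cast
  have e4 : ∀ i : Fin n, absRowSum n (mulTable n d T (rowsOf fun a t => Φ t a)) i ≤ κ * s ↔
      ∑ b, |(matrixOf n d T * Φ) i b| ≤ κ * s := fun i => by
    rw [← matrixOf_mulTable, ← absRowSum_eq]
    norm_cast
  constructor
  · rintro ⟨h0, h1, h⟩
    refine ⟨fun b => ?_, h0, fun i => (e1 i).1 (h i i.2).1, fun i => (e2 i).1 (h i i.2).2.1,
      fun i => (e3 i).1 (h i i.2).2.2.1, fun i => (e4 i).1 (h i i.2).2.2.2⟩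
    have := h1 b b.2
    rwa [getD_tableOf, List.length_map] at this
  · rintro ⟨h1, h⟩
    refine ⟨h.pos, fun b hb => ?_, fun i hi => ⟨(e1 ⟨i, hi⟩).2 (h.inner _),
      (e2 ⟨i, hi⟩).2 (h.future _), (e3 ⟨i, hi⟩).2 (h.last _), (e4 ⟨i, hi⟩).2 (h.bound _)⟩⟩
    have := h1 ⟨b, hb⟩
    rwa [← List.length_map (f := Fin.val), ← getD_tableOf] at this

theorem prefixWeight_eq {d : ℕ} (Φ : Matrix (Fin d) (Fin n) ℤ) (t : Fin d) (W : List (Fin n))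
    (p : ℕ) : prefixWeight (rowsOf fun a t => Φ t a) t (W.map Fin.val) p =
      Φ.mulVec (parikh (W.take p)) t := by
  rw [prefixWeight, ← List.map_take, List.map_map, Matrix.mulVec, dotProduct, ← sum_map_eq_parikh]
  congr 1
  exact List.map_congr_left fun a _ => matEntry_rowsOf _ _ _

theorem cutsPower_iff {d : ℕ} (k : ℕ) (Φ : Matrix (Fin d) (Fin n) ℤ) (W : List (Fin n))
    (l : List ℕ) :
    CutsPower d k (rowsOf fun a t => Φ t a) (W.map Fin.val) l ↔
      (∀ j < k, l.getD j 0 ≤ l.getD (j + 1) 0) ∧ l.getD 0 0 < l.getD k 0 ∧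
        ∀ j, j + 2 ≤ k → Φ.mulVec (secondDiff W (fun j => l.getD j 0) j) = 0 := by
  have key : ∀ j, (∀ t < d, prefixWeight (rowsOf fun a t => Φ t a) t (W.map Fin.val)
      (l.getD (j + 2) 0) + prefixWeight (rowsOf fun a t => Φ t a) t (W.map Fin.val)
        (l.getD j 0) = prefixWeight (rowsOf fun a t => Φ t a) t (W.map Fin.val)
      (l.getD (j + 1) 0) + prefixWeight (rowsOf fun a t => Φ t a) t (W.map Fin.val)
      (l.getD (j + 1) 0)) ↔ Φ.mulVec (secondDiff W (fun j => l.getD j 0) j) = 0 := fun j => by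
    simp only [funext_iff, secondDiff, Matrix.mulVec_add, Matrix.mulVec_sub, Pi.add_apply,
      Pi.sub_apply, Pi.zero_apply]
    constructor
    · intro h t
      have := h t t.2
      simp only [prefixWeight_eq] at this
      linarith
    · intro h t ht
      have := h ⟨t, ht⟩
      simp only [prefixWeight_eq Φ ⟨t, ht⟩]
      linarith
  unfold CutsPower
  refine and_congr_right fun _ => and_congr_right fun _ => ?_
  constructor
  · exact fun h j hj => (key j).1 (h j (by omega))
  · exact fun h j hj => (key j).2 (h j (by omega))

/-- Only the values of a cut at `0, …, k` matter, and they are at most the length of the word; so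
finitely many lists cover all cuts. -/
theorem noPowerUpTo_iff {d : ℕ} (m k : ℕ) (g : Fin n → List (Fin n))
    (Φ : Matrix (Fin d) (Fin n) ℤ) :
    NoPowerUpTo m n d k (tableOf g) (rowsOf fun a t => Φ t a) ↔
      ∀ i < m, ∀ a, ¬ ∃ p, IsGoodCut k (fun x => Φ.mulVec x = 0)
        ((List.flatMap g)^[i + 1] [a]) p := by
  have hW : ∀ i (a : Fin n), (substWord (tableOf g))^[i] [(a : ℕ)] =
      ((List.flatMap g)^[i] [a]).map Fin.val := fun i a => substWord_iterate_tableOf g i [a]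
  constructor
  · rintro h i hi a ⟨p, hp, hlt, hQ⟩
    have get : ∀ j ≤ k, ((List.range (k + 1)).map p).getD j 0 = p j := fun j hj => by
      rw [List.getD_eq_getElem _ _ (by simp; omega)]
      simp
    refine h i hi a a.2 ((List.range (k + 1)).map p) (mem_tuples.2 ⟨by simp, ?_⟩) ?_
    · intro x hx
      obtain ⟨j, hj, rfl⟩ := List.mem_map.1 hx
      have := hp.2 j (by simp at hj; omega)
      rw [hW, List.length_map]
      omega
    · rw [hW, cutsPower_iff]
      refine ⟨fun j hj => ?_, ?_, fun j hj => ?_⟩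
      · rw [get j hj.le, get (j + 1) hj]
        exact hp.1 j hj
      · rwa [get 0 (Nat.zero_le k), get k le_rfl]
      · simp only [secondDiff, get _ hj, get (j + 1) (by omega), get j (by omega)]
        exact hQ j hj
  · intro h i hi a ha l hl hcut
    rw [show a = ((⟨a, ha⟩ : Fin n) : ℕ) from rfl, hW] at hl hcut
    rw [cutsPower_iff] at hcut
    rw [mem_tuples, List.length_map] at hl
    refine h i hi ⟨a, ha⟩ ⟨fun j => l.getD j 0, ⟨hcut.1, fun j hj => ?_⟩, hcut.2⟩
    have hj' : j < l.length := by omega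
    have := hl.2 _ (List.getElem_mem hj')
    change l.getD j 0 ≤ _
    rw [List.getD_eq_getElem _ _ hj']
    omega

end Tables

/-! ### Powers and cuts -/

section Powers

variable {n d : ℕ}

theorem toAdd_apply_eq (Φ : FreeMonoid (Fin n) →* Multiplicative (Fin d → ℤ))
    (w : FreeMonoid (Fin n)) : (Φ w).toAdd = (weightMatrix Φ).mulVec (parikh w.toList) := by
  induction w using FreeMonoid.inductionOn' with
  | one =>
    rw [map_one, FreeMonoid.toList_one, toAdd_one]
    exact (Matrix.mulVec_zero _).symm
  | of_mul a w ih =>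
    rw [map_mul, toAdd_mul, ih, FreeMonoid.toList_of_mul, ← List.singleton_append, parikh_append,
      Matrix.mulVec_add]
    congr 1
    ext t
    rw [Matrix.mulVec, dotProduct, ← sum_map_eq_parikh]
    simp [weightMatrix]

theorem isPowerModulo_iff {A G : Type*} [Monoid G] (Φ : FreeMonoid A →* G) (k : ℕ)
    (w : FreeMonoid A) : IsPowerModulo Φ k w ↔ ∃ u : ℕ → FreeMonoid A,
      w = ((List.range k).map u).prod ∧ ∀ j, j + 2 ≤ k → Φ (u j) = Φ (u (j + 1)) := by
  have hofFn : ∀ u : ℕ → FreeMonoid A,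
      List.ofFn (fun i : Fin k => u i) = (List.range k).map u := fun u => by
    apply List.ext_getElem <;> simp
  constructor
  · rintro ⟨u, rfl, hu⟩
    refine ⟨fun j => if h : j < k then u ⟨j, h⟩ else 1, ?_, fun j hj => ?_⟩
    · rw [← hofFn]
      simp
    · simp only [show j < k by omega, show j + 1 < k by omega, dite_true]
      exact hu _ _
  · rintro ⟨u, rfl, hu⟩
    refine ⟨fun i => u i, by rw [hofFn], ?_⟩
    have h0 : ∀ j < k, Φ (u 0) = Φ (u j) := fun j hj => by
      induction j with
      | zero => rfl
      | succ j ih => exact (ih (by omega)).trans (hu j hj)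
    exact fun i j => (h0 i i.2).symm.trans (h0 j j.2)

/-- The second difference at `j` is the Parikh vector of block `j + 1` minus that of block `j`; its
image vanishes exactly when the two blocks have the same weight. -/
theorem exists_isGoodCut_iff (Φ : FreeMonoid (Fin n) →* Multiplicative (Fin d → ℤ)) (k : ℕ)
    (W : FreeMonoid (Fin n)) :
    (∃ p, IsGoodCut k (fun x => (weightMatrix Φ).mulVec x = 0) W.toList p) ↔
      ∃ u, IsFactor u W ∧ u ≠ 1 ∧ IsPowerModulo Φ k u := by
  constructor
  · rintro ⟨p, hp, hlt, hQ⟩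
    let u : ℕ → FreeMonoid (Fin n) := fun j =>
      FreeMonoid.ofList ((W.toList.take (p (j + 1))).drop (p j))
    have htake : ∀ j < k, W.toList.take (p j) ++ (u j).toList = W.toList.take (p (j + 1)) :=
      fun j hj => by
        conv_rhs => rw [← List.take_append_drop (p j) (W.toList.take (p (j + 1))),
          List.take_take, min_eq_left (hp.1 j hj)]
        rfl
    have hprod : ∀ j ≤ k, W.toList.take (p 0) ++ (((List.range j).map u).prod).toList =
        W.toList.take (p j) := fun j hj => by
      induction j with
      | zero => simp
      | succ j ih =>
        rw [List.prod_range_succ, FreeMonoid.toList_mul, ← List.append_assoc, ih (by omega),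
          htake j hj]
    refine ⟨((List.range k).map u).prod, ⟨FreeMonoid.ofList (W.toList.take (p 0)),
      FreeMonoid.ofList (W.toList.drop (p k)), ?_⟩, fun h1 => ?_,
      (isPowerModulo_iff _ _ _).2 ⟨u, rfl, fun j hj => ?_⟩⟩
    · apply FreeMonoid.toList.injective
      rw [FreeMonoid.toList_mul, FreeMonoid.toList_mul, FreeMonoid.toList_ofList,
        FreeMonoid.toList_ofList, hprod k le_rfl, List.take_append_drop]
    · have := congrArg List.length (hprod k le_rfl)
      rw [h1] at this
      have h2 := hp.2 k le_rfl
      simp at this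
      omega
    · apply Multiplicative.toAdd.injective
      rw [toAdd_apply_eq, toAdd_apply_eq]
      have h0 := hQ j hj
      have e1 := congrArg parikh (htake j (by omega))
      have e2 := congrArg parikh (htake (j + 1) (by omega))
      rw [parikh_append] at e1 e2
      rw [← sub_eq_zero, ← Matrix.mulVec_sub, ← neg_eq_zero, ← Matrix.mulVec_neg, ← h0]
      congr 1
      rw [secondDiff, ← e2, ← e1]
      abel
  · rintro ⟨u, ⟨x, y, rfl⟩, hne, hu⟩
    obtain ⟨u, rfl, hu'⟩ := (isPowerModulo_iff _ _ _).1 hu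
    obtain ⟨q, hqd⟩ : ∃ q : ℕ → FreeMonoid (Fin n), ∀ j, q j = x * ((List.range j).map u).prod :=
      ⟨_, fun _ => rfl⟩
    have hq : ∀ j, q (j + 1) = q j * u j := fun j => by
      simp only [hqd, List.prod_range_succ, mul_assoc]
    have hW : ∀ j ≤ k, ∃ z, x * ((List.range k).map u).prod * y = q j * z := by
      intro j hj
      obtain ⟨m, rfl⟩ := Nat.exists_eq_add_of_le hj
      have : ∀ m, ∃ z, q (j + m) = q j * z := fun m => by
        induction m with
        | zero => exact ⟨1, (mul_one _).symm⟩
        | succ m ih =>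
          obtain ⟨z, hz⟩ := ih
          exact ⟨z * u (j + m), by rw [← add_assoc, hq, hz, mul_assoc]⟩
      obtain ⟨z, hz⟩ := this m
      exact ⟨z * y, by rw [← mul_assoc, ← hz, hqd]⟩
    have htake : ∀ j ≤ k, (x * ((List.range k).map u).prod * y).toList.take (q j).toList.length =
        (q j).toList := fun j hj => by
      obtain ⟨z, hz⟩ := hW j hj
      rw [hz, FreeMonoid.toList_mul, List.take_left]
    refine ⟨fun j => (q j).toList.length, ⟨fun j hj => ?_, fun j hj => ?_⟩, ?_, fun j hj => ?_⟩
    · dsimp only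
      rw [hq, FreeMonoid.toList_mul, List.length_append]
      omega
    · obtain ⟨z, hz⟩ := hW j hj
      dsimp only
      rw [hz, FreeMonoid.toList_mul, List.length_append]
      omega
    · have : (((List.range k).map u).prod).toList ≠ [] := fun h =>
        hne (FreeMonoid.toList.injective h)
      have := List.length_pos_iff.2 this
      simp only [hqd, FreeMonoid.toList_mul, List.length_append, List.range_zero, List.map_nil,
        List.prod_nil, FreeMonoid.toList_one, List.length_nil]
      omega
    · have h1 := congrArg Multiplicative.toAdd (hu' j hj)
      rw [toAdd_apply_eq, toAdd_apply_eq] at h1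
      simp only [secondDiff, htake _ hj, htake (j + 1) (by omega), htake j (by omega)]
      rw [show j + 2 = j + 1 + 1 from rfl, hq (j + 1), hq j, FreeMonoid.toList_mul,
        FreeMonoid.toList_mul, parikh_append, parikh_append]
      simp only [Matrix.mulVec_add, Matrix.mulVec_sub, h1]
      abel

end Powers

/-! ### Factors of iterates -/

section Factors

variable {A : Type*}

theorem IsFactor.trans {u v w : FreeMonoid A} (h₁ : IsFactor u v) (h₂ : IsFactor v w) :
    IsFactor u w := by
  obtain ⟨p, s, rfl⟩ := h₁
  obtain ⟨p', s', rfl⟩ := h₂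
  exact ⟨p' * p, s * s', by simp only [mul_assoc]⟩

theorem IsFactor.iterate {u w : FreeMonoid A} (h : FreeMonoid A →* FreeMonoid A) (i : ℕ)
    (hu : IsFactor u w) : IsFactor (h^[i] u) (h^[i] w) := by
  obtain ⟨p, s, rfl⟩ := hu
  exact ⟨h^[i] p, h^[i] s, by rw [iterate_map_mul, iterate_map_mul]⟩

theorem isFactor_of_iff {a : A} {w : FreeMonoid A} :
    IsFactor (FreeMonoid.of a) w ↔ a ∈ w.toList := by
  constructor
  · rintro ⟨p, s, rfl⟩
    simp [FreeMonoid.toList_mul]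
  · intro h
    obtain ⟨s, t, e⟩ := List.append_of_mem h
    refine ⟨FreeMonoid.ofList s, FreeMonoid.ofList t, FreeMonoid.toList.injective ?_⟩
    rw [e, FreeMonoid.toList_mul, FreeMonoid.toList_mul]
    simp

theorem exists_isFactor_of_ne_one {w : FreeMonoid A} (h : w ≠ 1) :
    ∃ a, IsFactor (FreeMonoid.of a) w := by
  have : w.toList ≠ [] := fun e => h (FreeMonoid.toList.injective e)
  obtain ⟨a, ha⟩ := List.exists_mem_of_ne_nil _ this
  exact ⟨a, isFactor_of_iff.2 ha⟩

/-- All iterates from the `m`-th on map each letter to a word containing every letter. With `i' = i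
+ m`, the word `h^(N * i')(a)` is the image under `h^i` of such a word, which contains `a`. -/
theorem IsPrimitive.exists_isFactor {h : FreeMonoid A →* FreeMonoid A} (hh : IsPrimitive h)
    {N : ℕ} (hN : 1 ≤ N) {i : ℕ} (hi : 1 ≤ i) (a : A) :
    ∃ i', 1 ≤ i' ∧ IsFactor (h^[i] (FreeMonoid.of a)) (h^[N * i'] (FreeMonoid.of a)) := by
  -- If `h` erases `a`, then `h^i(a)` is empty and is a factor of anything.
  by_cases h1 : h (FreeMonoid.of a) = 1
  · obtain ⟨r, rfl⟩ := Nat.exists_eq_add_of_le' hi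
    refine ⟨1, le_rfl, ?_⟩
    rw [Function.iterate_succ_apply, h1, iterate_map_one]
    exact ⟨1, h^[N * 1] (FreeMonoid.of a), by simp⟩
  obtain ⟨m, hm1, hm⟩ : ∃ m, 1 ≤ m ∧
      ∀ b c : A, IsFactor (FreeMonoid.of c) (h^[m] (FreeMonoid.of b)) := by
    obtain ⟨m, hm⟩ := hh
    -- The exponent `0` forces a one-letter alphabet; the nonempty word `h(a)` then allows the
    -- exponent `1`.
    rcases Nat.eq_zero_or_pos m with rfl | hpos
    · have hsub : ∀ b c : A, c = b := fun b c => by simpa using hm b c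
      obtain ⟨c, hc⟩ := exists_isFactor_of_ne_one h1
      refine ⟨1, le_rfl, fun b c' => ?_⟩
      rw [hsub c c', hsub a b]
      exact hc
    · exact ⟨m, hpos, fun b c => isFactor_of_iff.2 (hm b c)⟩
  have hall : ∀ r (b c : A), IsFactor (FreeMonoid.of c) (h^[m + r] (FreeMonoid.of b)) := by
    intro r
    induction r with
    | zero => exact hm
    | succ r ih =>
      intro b c
      have hb : h (FreeMonoid.of b) ≠ 1 := fun h0 => by
        have := hm b c
        obtain ⟨l, rfl⟩ := Nat.exists_eq_add_of_le' hm1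
        rw [Function.iterate_succ_apply, h0, iterate_map_one, isFactor_of_iff] at this
        simp at this
      obtain ⟨e, he⟩ := exists_isFactor_of_ne_one hb
      rw [← add_assoc, Function.iterate_succ_apply]
      exact (ih e c).trans (he.iterate h _)
  refine ⟨i + m, by omega, ?_⟩
  have hle : i + m ≤ N * (i + m) := Nat.le_mul_of_pos_left _ hN
  obtain ⟨r, hr⟩ := Nat.exists_eq_add_of_le hle
  rw [hr, add_assoc, Function.iterate_add_apply]
  exact (hall r a a).iterate h i

end Factors

/-! ### From morphisms of free monoids to tables of substitutions -/

section Main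

variable {n d : ℕ}

/-- The images of the letters under `h`. -/
def letterImage (h : FreeMonoid (Fin n) →* FreeMonoid (Fin n)) (a : Fin n) : List (Fin n) :=
  (h (FreeMonoid.of a)).toList

theorem toList_apply (h : FreeMonoid (Fin n) →* FreeMonoid (Fin n)) (w : FreeMonoid (Fin n)) :
    (h w).toList = w.toList.flatMap (letterImage h) := by
  induction w using FreeMonoid.inductionOn' with
  | one => simp
  | of_mul a w ih =>
    rw [map_mul, FreeMonoid.toList_mul, ih, FreeMonoid.toList_of_mul, List.flatMap_cons]
    rfl

theorem toList_iterate (h : FreeMonoid (Fin n) →* FreeMonoid (Fin n)) (i : ℕ)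
    (w : FreeMonoid (Fin n)) :
    (h^[i] w).toList = (List.flatMap (letterImage h))^[i] w.toList := by
  induction i generalizing w with
  | zero => rfl
  | succ i ih => rw [Function.iterate_succ_apply, Function.iterate_succ_apply, ih, toList_apply]

theorem forall_factInfty_iff {h : FreeMonoid (Fin n) →* FreeMonoid (Fin n)} (hh : IsPrimitive h)
    (Φ : FreeMonoid (Fin n) →* Multiplicative (Fin d → ℤ)) (k : ℕ) {N : ℕ} (hN : 1 ≤ N) :
    (∀ w ∈ factInfty h, IsPowerFreeModulo Φ k w) ↔
      ∀ i, 1 ≤ i → ∀ a, ¬ ∃ p, IsGoodCut k (fun x => (weightMatrix Φ).mulVec x = 0)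
        ((List.flatMap (iterSubst (letterImage h) N))^[i] [a]) p := by
  have hW : ∀ i a, (List.flatMap (iterSubst (letterImage h) N))^[i] [a] =
      (h^[N * i] (FreeMonoid.of a)).toList := fun i a => by
    rw [flatMap_iterSubst_iterate, toList_iterate, FreeMonoid.toList_of]
  simp only [hW, exists_isGoodCut_iff]
  constructor
  · rintro hfree i hi a ⟨u, hu, hne, hpow⟩
    exact hfree _ ⟨N * i, Nat.mul_pos hN hi, a, 1, 1, by simp⟩ u hu hne hpow
  · rintro hno w ⟨i, hi, a, hw⟩ u hu hne hpow
    obtain ⟨i', hi', hf⟩ := hh.exists_isFactor hN hi a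
    exact hno i' hi' a ⟨u, (hu.trans hw).trans hf, hne, hpow⟩

theorem inputData_eq (k : ℕ) (h : FreeMonoid (Fin n) →* FreeMonoid (Fin n))
    (Φ : FreeMonoid (Fin n) →* Multiplicative (Fin d → ℤ)) :
    inputData k h Φ =
      (d, k, tableOf (letterImage h), rowsOf fun a t => weightMatrix Φ t a) := rfl

theorem certifies_inputData_iff (k : ℕ) (h : FreeMonoid (Fin n) →* FreeMonoid (Fin n))
    (Φ : FreeMonoid (Fin n) →* Multiplicative (Fin d → ℤ)) (N s κ ℓ : ℕ) (B T : List (List ℤ)) :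
    Certifies (inputData k h Φ) (N, s, B, T, κ, ℓ) ↔
      1 ≤ N ∧ (∀ b, (iterSubst (letterImage h) N b).length ≤ ℓ) ∧
        HyperbolicCertificate (substMatrix (iterSubst (letterImage h) N)) (matrixOf n n B)
          (matrixOf n d T * weightMatrix Φ) s κ := by
  rw [Certifies, inputData_eq]
  dsimp only
  rw [iterTable_tableOf, show (tableOf (letterImage h)).length = n by simp [tableOf],
    certifiesTable_iff]

theorem matrixOf_rowsOf {m : ℕ} (X : Matrix (Fin n) (Fin m) ℤ) :
    matrixOf n m (rowsOf X) = X := by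
  ext i j
  exact matEntry_rowsOf _ _ _

end Main

end PowerFree

theorem mainTheorem7 :
    ∃ algo : ℕ × ℕ × List (List ℕ) × List (List ℤ) →. Bool,
      Partrec algo ∧
      ∀ (n d k : ℕ) (h : FreeMonoid (Fin n) →* FreeMonoid (Fin n))
        (Φ : FreeMonoid (Fin n) →* Multiplicative (Fin d → ℤ)),
        2 ≤ k →
        PowerFree.IsPrimitive h →
        (∀ μ : ℂ, (PowerFree.morphismEnd h).HasEigenvalue μ → ‖μ‖ ≠ 1) →
        PowerFree.expandingEigenspace (PowerFree.morphismEnd h) ⊓ PowerFree.weightKer Φ = ⊥ →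
        ∃ answer ∈ algo (PowerFree.inputData k h Φ),
          (answer = true ↔
            ∀ w ∈ PowerFree.factInfty h, PowerFree.IsPowerFreeModulo Φ k w) := by
  open PowerFree in
  refine ⟨decider, partrec_decider, fun n d k h Φ _ hprim heig hker => exists_mem_decider ?_ ?_⟩
  · have hEnd : morphismEnd h =
        Matrix.toLin' ((substMatrix (letterImage h)).map (Int.cast : ℤ → ℂ)) := by
      rw [morphismEnd]
      congr 1
    rw [hEnd] at heig hker
    obtain ⟨N, hN, B, T, s, κ, hcert⟩ := exists_hyperbolicCertificate _ _ heig hker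
    refine ⟨(N, s, rowsOf B, rowsOf T, κ, ∑ b, (iterSubst (letterImage h) N b).length),
      (certifies_inputData_iff k h Φ _ _ _ _ _ _).2 ⟨hN, fun b => ?_, ?_⟩⟩
    · exact Finset.single_le_sum (f := fun b => (iterSubst (letterImage h) N b).length)
        (fun _ _ => Nat.zero_le _) (Finset.mem_univ b)
    · rwa [substMatrix_iterSubst, matrixOf_rowsOf, matrixOf_rowsOf]
  · rintro ⟨N, s, B, T, κ, ℓ⟩ hc
    obtain ⟨hN, hl, hcert⟩ := (certifies_inputData_iff k h Φ _ _ _ _ _ _).1 hc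
    rw [forall_factInfty_iff hprim Φ k hN, CertifiedAnswer, inputData_eq]
    dsimp only
    rw [iterTable_tableOf, show (tableOf (letterImage h)).length = n by simp [tableOf],
      noPowerUpTo_iff]
    constructor
    · intro hno i hi a hex
      -- The matrix `U` is `T Φ`, so it kills whatever `Φ` kills.
      obtain ⟨i', hi', hle, hex'⟩ := exists_good_cut_le hcert hl
        (fun x hx => by rw [← Matrix.mulVec_mulVec, hx, Matrix.mulVec_zero]) k a ⟨i, hi, hex⟩
      -- Index `r` of the bounded check stands for level `r + 1`.
      obtain ⟨r, rfl⟩ := Nat.exists_eq_add_of_le' hi'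
      exact hno r hle a hex'
    · exact fun hno i _ a => hno (i + 1) (Nat.le_add_left 1 i) a
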